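/- Let $p\ge 5$ be a prime and let $E/\mathbb{Q}$ be an elliptic curve with good ordinary reduction at $p$. Let $\Sigma$ be a finite set of primes containing $p$ and all primes of bad reduction of $E$, let $\mathbb{Q}_\Sigma$ be the maximal extension of $\mathbb{Q}$ in which all primes $l\notin\Sigma$ are unramified, and let $E_{p^\infty}$ be the Galois module of $p$-power torsion points of $E$. For a subfield $L\subset\mathbb{Q}_\Sigma$ let $$\operatorname{Sel}(E/L)=\ker\Big(H^1(\operatorname{Gal}(\mathbb{Q}_\Sigma/L),E_{p^\infty})\to\prod_{l\in\Sigma}\prod_{w\mid l}H^1(L_w,E)\Big),$$ where $w$ runs over the places of $L$ above $l$ and $L_w$ is the union of the completions at $w$ of the finite extensions of $\mathbb{Q}$ contained in $L$. If $L/\mathbb{Q}$ is Galois, $\operatorname{Sel}(E/L)$ is a discrete $p$-primary $\operatorname{Gal}(L/\mathbb{Q})$-module. Let $\mathbb{Q}^{cyc}\subset\mathbb{Q}(\mu_{p^\infty})$ be the cyclotomic $\mathbb{Z}_p$-extension of $\mathbb{Q}$, that is, the fixed field of the torsion subgroup of $\Gamma'=\operatorname{Gal}(\mathbb{Q}(\mu_{p^\infty})/\mathbb{Q})\simeq\mathbb{Z}_p^\times$,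 and put $\Gamma=\operatorname{Gal}(\mathbb{Q}^{cyc}/\mathbb{Q})$ and $\Delta=\operatorname{Gal}(\mathbb{Q}(\mu_{p^\infty})/\mathbb{Q}^{cyc})$, so that $\Gamma'/\Delta\simeq\Gamma$. Fix a topological generator $\gamma$ of $\Gamma$; for a discrete $p$-primary $\Gamma$-module $D$, evaluation of cocycles at $\gamma$ gives an isomorphism $H^1(\Gamma,D)\simeq D_\Gamma$. For a discrete $p$-primary $\Gamma$-module $D$ let $\phi_D:D^\Gamma\to D_\Gamma$ send $x$ to its residue class. If $\ker\phi_D$ and $\operatorname{cok}\phi_D$ are finite, one says that $\chi_t(\Gamma,D)$ is finite and sets $\chi_t(\Gamma,D)=\#\ker\phi_D/\#\operatorname{cok}\phi_D$. For a discrete $p$-primary $\Gamma'$-module $D$ let $\psi_D:H^0(\Gamma,D^\Delta)\to H^1(\Gamma',D)$ be the composite of $\phi_{D^\Delta}:H^0(\Gamma,D^\Delta)\to (D^\Delta)_\Gamma\simeq H^1(\Gamma,D^\Delta)$ with the inflation map. If $\ker\psi_D$ and $\operatorname{cok}\psi_D$ are finite, one says that $\chi_t(\Gamma',D)$ is finite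 and sets $\chi_t(\Gamma',D)=\#\ker\psi_D/\#\operatorname{cok}\psi_D$. Put $$\chi_t(\Gamma,E)=\chi_t(\Gamma,\operatorname{Sel}(E/\mathbb{Q}^{cyc})),\qquad \chi_t(\Gamma',E)=\chi_t(\Gamma',\operatorname{Sel}(E/\mathbb{Q}(\mu_{p^\infty}))).$$ Then $\chi_t(\Gamma,E)$ is finite if and only if $\chi_t(\Gamma',E)$ is finite, and if they are finite, then $\chi_t(\Gamma,E)=\chi_t(\Gamma',E)$. -/

import Mathlib

noncomputable section

namespace TruncatedEuler

/-! ### Continuous cohomology of discrete modules in degree one -/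

section Cohomology

variable (G : Type*) [Group G] [TopologicalSpace G] (M : Type*) [AddCommGroup M]
  [DistribMulAction G M]

/-- Continuous `1`-cocycles of `G` with values in `M`, where `M` carries the discrete topology
(so that continuous means locally constant). -/
def Z1 : AddSubgroup (G → M) where
  carrier := {z | IsLocallyConstant z ∧ ∀ g h, z (g * h) = z g + g • z h}
  zero_mem' := ⟨IsLocallyConstant.const 0, by simp⟩
  add_mem' := by
    rintro a b ⟨ha, ha'⟩ ⟨hb, hb'⟩
    refine ⟨ha.add hb, fun g h => ?_⟩
    simp only [Pi.add_apply, ha', hb', smul_add]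
    abel
  neg_mem' := by
    rintro a ⟨ha, ha'⟩
    refine ⟨ha.neg, fun g h => ?_⟩
    simp only [Pi.neg_apply, ha', smul_neg]
    abel

/-- The `1`-coboundaries `g ↦ g m - m`. -/
def B1 : AddSubgroup (Z1 G M) where
  carrier := {z | ∃ m : M, ∀ g, z.1 g = g • m - m}
  zero_mem' := ⟨0, by simp⟩
  add_mem' := by
    rintro a b ⟨m, hm⟩ ⟨n, hn⟩
    refine ⟨m + n, fun g => ?_⟩
    simp only [AddSubgroup.coe_add, Pi.add_apply, hm, hn, smul_add]
    abel
  neg_mem' := by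
    rintro a ⟨m, hm⟩
    refine ⟨-m, fun g => ?_⟩
    simp only [AddSubgroup.coe_neg, Pi.neg_apply, hm, smul_neg]
    abel

/-- The continuous cohomology group `H¹(G, M)` of a discrete `G`-module `M`. -/
abbrev H1 : Type _ := Z1 G M ⧸ B1 G M

variable {G M}
variable {G' : Type*} [Group G'] [TopologicalSpace G'] {M' : Type*} [AddCommGroup M']
  [DistribMulAction G' M']

/-- The map on continuous cocycles attached to a continuous homomorphism `φ : G' → G` and a
compatible homomorphism `f : M → M'`. -/
def Z1.map (φ : G' →* G) (hφ : Continuous φ) (f : M →+ M')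
    (hf : ∀ g m, f (φ g • m) = g • f m) : Z1 G M →+ Z1 G' M' where
  toFun z := ⟨fun g => f (z.1 (φ g)), (z.2.1.comp_continuous hφ).comp f, fun g h => by
    simp only [map_mul, z.2.2, map_add, hf]⟩
  map_zero' := by ext; simp
  map_add' a b := by ext; simp

/-- Functoriality of `H¹` in compatible pairs; restriction, inflation, conjugation and
localization are all instances of it. -/
def H1.map (φ : G' →* G) (hφ : Continuous φ) (f : M →+ M')
    (hf : ∀ g m, f (φ g • m) = g • f m) : H1 G M →+ H1 G' M' :=
  QuotientAddGroup.map _ _ (Z1.map φ hφ f hf) (by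
    rintro z ⟨m, hm⟩
    exact ⟨f m, fun g => by simp [Z1.map, hm, hf]⟩)

/-- The action of `G` on `H¹(N, M)` for a normal subgroup `N` and a `G`-module `M`:
`(g z)(n) = g z(g⁻¹ n g)`. -/
instance H1.instDistribMulAction [IsTopologicalGroup G] (N : Subgroup G) [N.Normal] :
    DistribMulAction G (H1 N M) where
  smul g := H1.map (MulAut.conjNormal g⁻¹ : N ≃* N).toMonoidHom
    (Continuous.subtype_mk (by
      show Continuous fun n : N => g⁻¹ * (n : G) * g⁻¹⁻¹
      fun_prop) _)
    (DistribSMul.toAddMonoidHom M g) (fun n m => by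
      simp [Subgroup.smul_def, smul_smul, mul_assoc])
  one_smul c := by
    induction c using QuotientAddGroup.induction_on with
    | H z =>
      refine congrArg (QuotientAddGroup.mk' (B1 N M)) (Subtype.ext (funext fun n => ?_))
      simp [Z1.map]
  mul_smul a b c := by
    induction c using QuotientAddGroup.induction_on with
    | H z =>
      refine congrArg (QuotientAddGroup.mk' (B1 N M)) (Subtype.ext (funext fun n => ?_))
      simp [Z1.map, mul_smul]
  smul_zero _ := map_zero _
  smul_add _ := map_add _

theorem H1.smul_mk [IsTopologicalGroup G] (N : Subgroup G) [N.Normal] (g : G) (z : Z1 N M) :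
    ∃ z' : Z1 N M, (g • (z : H1 N M) = (z' : H1 N M)) ∧
      ∀ n, z'.1 n = g • z.1 (MulAut.conjNormal g⁻¹ n) :=
  ⟨_, rfl, fun _ => rfl⟩

theorem H1.smul_of_mem [IsTopologicalGroup G] (N : Subgroup G) [N.Normal] (g : G) (hg : g ∈ N)
    (c : H1 N M) : g • c = c := by
  induction c using QuotientAddGroup.induction_on with
  | H z =>
    obtain ⟨z', h1, h2⟩ := H1.smul_mk N g z
    rw [h1, QuotientAddGroup.eq]
    refine ⟨-z.1 ⟨g, hg⟩, fun n => ?_⟩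
    have e1 : (MulAut.conjNormal g⁻¹ n : N) = ⟨g, hg⟩⁻¹ * n * ⟨g, hg⟩ := by
      ext; simp
    have e2 := z.2.2 ⟨g, hg⟩ (⟨g, hg⟩⁻¹ * n * ⟨g, hg⟩)
    rw [show (⟨g, hg⟩ : N) * (⟨g, hg⟩⁻¹ * n * ⟨g, hg⟩) = n * ⟨g, hg⟩ by group, z.2.2] at e2
    have e3 : z'.1 n = z.1 n + n • z.1 ⟨g, hg⟩ - z.1 ⟨g, hg⟩ := by
      rw [h2, e1, eq_sub_iff_add_eq, add_comm, e2]
      rfl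
    simp only [AddSubgroup.coe_add, AddSubgroup.coe_neg, Pi.add_apply, Pi.neg_apply, e3, smul_neg]
    abel

end Cohomology

/-- If `π : G → Q` is a surjective homomorphism whose kernel acts trivially on the `G`-module `X`,
then `X` is a `Q`-module: `q` acts as any of its lifts to `G`. -/
@[reducible]
def descend {G Q X : Type*} [Group G] [Group Q] [AddCommGroup X] [DistribMulAction G X]
    (π : G →* Q) (hπ : Function.Surjective π) (h : ∀ g, π g = 1 → ∀ x : X, g • x = x) :
    DistribMulAction Q X :=
  have key : ∀ g g' : G, π g = π g' → ∀ x : X, g • x = g' • x := fun g g' e x => by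
    have := h (g'⁻¹ * g) (by simp [e]) x
    rw [mul_smul, inv_smul_eq_iff] at this
    exact this
  { smul := fun q x => Function.surjInv hπ q • x
    one_smul := fun x => (key _ 1 (by rw [Function.surjInv_eq hπ, map_one]) x).trans (one_smul _ x)
    mul_smul := fun a b x => (key _ (Function.surjInv hπ a * Function.surjInv hπ b) (by
      rw [map_mul, Function.surjInv_eq hπ, Function.surjInv_eq hπ, Function.surjInv_eq hπ]) x).trans
        (mul_smul _ _ x)
    smul_zero := fun _ => smul_zero _
    smul_add := fun _ => smul_add _ }

theorem descend_smul {G Q X : Type*} [Group G] [Group Q] [AddCommGroup X] [DistribMulAction G X]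
    (π : G →* Q) (hπ : Function.Surjective π) (h : ∀ g, π g = 1 → ∀ x : X, g • x = x) (g : G)
    (x : X) : (letI := descend π hπ h; π g • x) = g • x := by
  have e : π (Function.surjInv hπ (π g)) = π g := Function.surjInv_eq hπ _
  have := h (g⁻¹ * Function.surjInv hπ (π g)) (by simp [e]) x
  rw [mul_smul, inv_smul_eq_iff] at this
  exact this

/-! ### Truncated Euler characteristics -/

section EulerCharacteristic

/-- The invariants `H⁰(G, D) = D^G`. -/
def H0 (G D : Type*) [Group G] [AddCommGroup D] [DistribMulAction G D] : AddSubgroup D where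
  carrier := {d | ∀ g : G, g • d = d}
  zero_mem' := fun _ => smul_zero _
  add_mem' := fun ha hb g => by rw [smul_add, ha g, hb g]
  neg_mem' := fun ha g => by rw [smul_neg, ha g]

/-- The coinvariants `D_G = D / ⟨g d - d⟩`. -/
abbrev Coinv (G D : Type*) [Group G] [AddCommGroup D] [DistribMulAction G D] : Type _ :=
  D ⧸ AddSubgroup.closure {x : D | ∃ (g : G) (d : D), x = g • d - d}

/-- The natural map `φ_D : D^Γ → D_Γ` sending an invariant element to its residue class. -/
def phi (Γ D : Type*) [Group Γ] [AddCommGroup D] [DistribMulAction Γ D] :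
    H0 Γ D →+ Coinv Γ D :=
  (QuotientAddGroup.mk' _).comp (H0 Γ D).subtype

/-- `D` has finite truncated `Γ`-Euler characteristic: `φ_D` has finite kernel and cokernel. -/
def HasFiniteChi (Γ D : Type*) [Group Γ] [AddCommGroup D] [DistribMulAction Γ D] : Prop :=
  Finite (phi Γ D).ker ∧ Finite (Coinv Γ D ⧸ (phi Γ D).range)

/-- The truncated `Γ`-Euler characteristic `#ker φ_D / #coker φ_D`
(meaningful under `HasFiniteChi`). -/
def chi (Γ D : Type*) [Group Γ] [AddCommGroup D] [DistribMulAction Γ D] : ℚ :=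
  (Nat.card (phi Γ D).ker : ℚ) / (Nat.card (Coinv Γ D ⧸ (phi Γ D).range) : ℚ)

/-- Evaluation of cocycles at `γ`, as a map `H¹(Γ, D) → D_Γ`. -/
def evalAt {Γ : Type*} [Group Γ] [TopologicalSpace Γ] (D : Type*) [AddCommGroup D]
    [DistribMulAction Γ D] (γ : Γ) : H1 Γ D →+ Coinv Γ D :=
  QuotientAddGroup.map _ _ ((Pi.evalAddMonoidHom (fun _ : Γ => D) γ).comp (Z1 Γ D).subtype) (by
    rintro z ⟨m, hm⟩
    exact AddSubgroup.subset_closure ⟨γ, m, hm γ⟩)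

open scoped Classical in
/-- The isomorphism `D_Γ ≃ H¹(Γ, D)`, inverse to evaluation of cocycles at the topological
generator `γ`. For `Γ ≃ ℤ_p`, `γ` a topological generator and `D` a discrete `p`-primary
`Γ`-module, evaluation at `γ` is bijective (the value `0` is taken outside of this situation). -/
def coinvToH1 {Γ : Type*} [Group Γ] [TopologicalSpace Γ] (D : Type*) [AddCommGroup D]
    [DistribMulAction Γ D] (γ : Γ) : Coinv Γ D →+ H1 Γ D :=
  if h : Function.Bijective (evalAt D γ) then
    ((AddEquiv.ofBijective (evalAt D γ) h).symm : Coinv Γ D →+ H1 Γ D)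
  else 0

variable {G : Type*} [Group G] (H : Subgroup G) [H.Normal]
  (D : Type*) [AddCommGroup D] [DistribMulAction G D]

/-- `G` acts on `D^H` for a normal subgroup `H`. -/
instance H0.instDistribMulAction : DistribMulAction G (H0 H D) where
  smul g d := ⟨g • d.1, fun h => by
    have := d.2 (MulAut.conjNormal g⁻¹ h)
    rw [Subgroup.smul_def, MulAut.conjNormal_apply, mul_smul, mul_smul, inv_inv,
      inv_smul_eq_iff] at this
    exact this⟩
  one_smul d := Subtype.ext (one_smul G d.1)
  mul_smul a b d := Subtype.ext (mul_smul a b d.1)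
  smul_zero a := Subtype.ext (smul_zero a)
  smul_add a b d := Subtype.ext (smul_add a b.1 d.1)

theorem H0.smul_of_mk_eq_one (g : G) (hg : QuotientGroup.mk' H g = 1) (d : H0 H D) : g • d = d :=
  Subtype.ext (d.2 ⟨g, by rwa [QuotientGroup.mk'_apply, QuotientGroup.eq_one_iff] at hg⟩)

/-- The `G/H`-module structure on `D^H`. -/
instance H0.instQuotient : DistribMulAction (G ⧸ H) (H0 H D) :=
  descend (QuotientGroup.mk' H) (QuotientGroup.mk'_surjective H) (H0.smul_of_mk_eq_one H D)

theorem H0.mk_smul (g : G) (d : H0 H D) : (((g : G ⧸ H) • d : H0 H D) : D) = g • (d : D) :=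
  congrArg Subtype.val (descend_smul (QuotientGroup.mk' H) (QuotientGroup.mk'_surjective H)
    (H0.smul_of_mk_eq_one H D) g d)

variable [TopologicalSpace G]

/-- The inflation map `H¹(G/H, D^H) → H¹(G, D)`. -/
def inflation : H1 (G ⧸ H) (H0 H D) →+ H1 G D :=
  H1.map (QuotientGroup.mk' H) QuotientGroup.continuous_mk (H0 H D).subtype
    (fun g d => H0.mk_smul H D g d)

/-- With `Γ = G/H` and `γ` a topological generator of `Γ`, the map
`ψ_D : H⁰(Γ, D^H) → H¹(G, D)`: the composite of `φ : H⁰(Γ, D^H) → (D^H)_Γ ≃ H¹(Γ, D^H)` with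
inflation. -/
def psi (γ : G ⧸ H) : H0 (G ⧸ H) (H0 H D) →+ H1 G D :=
  ((inflation H D).comp (coinvToH1 (H0 H D) γ)).comp (phi (G ⧸ H) (H0 H D))

/-- `D` has finite truncated `G`-Euler characteristic: `ψ_D` has finite kernel and cokernel. -/
def HasFiniteChiG (γ : G ⧸ H) : Prop :=
  Finite (psi H D γ).ker ∧ Finite (H1 G D ⧸ (psi H D γ).range)

/-- The truncated `G`-Euler characteristic `#ker ψ_D / #coker ψ_D`
(meaningful under `HasFiniteChiG`). -/
def chiG (γ : G ⧸ H) : ℚ :=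
  (Nat.card (psi H D γ).ker : ℚ) / (Nat.card (H1 G D ⧸ (psi H D γ).range) : ℚ)

end EulerCharacteristic

/-! ### Fields -/

section Fields

/-- The algebra structure of an intermediate field of `F/ℚ` is the one inherited from `F`. -/
instance (priority := 5000) instAlgebraIntermediate {F : Type*} [Field F] [Algebra ℚ F]
    (L : IntermediateField ℚ F) : Algebra ℚ L := L.algebra'

instance (priority := 5000) instAlgebraRatClosure : Algebra ℚ (AlgebraicClosure ℚ) :=
  AlgebraicClosure.instAlgebra ℚ

instance instFactPrimes (l : Nat.Primes) : Fact (l : ℕ).Prime := ⟨l.2⟩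

/-- `ℚ_Σ`: the maximal extension of `ℚ` (in a fixed algebraic closure) in which all primes
`l ∉ Σ` are unramified, i.e. the compositum of all number fields unramified outside `Σ`. -/
def QSigma (S : Finset Nat.Primes) : IntermediateField ℚ (AlgebraicClosure ℚ) :=
  sSup {K | FiniteDimensional ℚ K ∧ ∀ l : Nat.Primes, l ∉ S →
    Algebra.IsUnramifiedIn (NumberField.RingOfIntegers K) (Ideal.span {(l : ℤ)})}

instance QSigma.instNormal (S : Finset Nat.Primes) : Normal ℚ (QSigma S) := by
  rw [IntermediateField.normal_iff_forall_map_le']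
  intro σ
  rw [IntermediateField.map_le_iff_le_comap]
  refine sSup_le ?_
  rintro K ⟨hK, hK'⟩
  rw [← IntermediateField.map_le_iff_le_comap]
  let e := K.equivMap (σ : AlgebraicClosure ℚ →ₐ[ℚ] AlgebraicClosure ℚ)
  have hfin : FiniteDimensional ℚ (K.map (σ : AlgebraicClosure ℚ →ₐ[ℚ] AlgebraicClosure ℚ)) :=
    Module.Finite.equiv e.toLinearEquiv
  refine le_sSup ⟨hfin, fun l hl => ?_⟩
  have : NumberField K := ⟨⟩
  have : NumberField (K.map (σ : AlgebraicClosure ℚ →ₐ[ℚ] AlgebraicClosure ℚ)) := ⟨⟩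
  have hp : Prime (l : ℤ) := Nat.prime_iff_prime_int.1 l.2
  have h := hK' l hl
  rw [← NumberField.not_dvd_discr_iff_isUnramifiedIn K _ hp] at h
  refine (NumberField.not_dvd_discr_iff_isUnramifiedIn
    (K.map (σ : AlgebraicClosure ℚ →ₐ[ℚ] AlgebraicClosure ℚ)) _ hp).1 ?_
  rwa [← NumberField.discr_eq_discr_of_ringEquiv K e.toRingEquiv]

instance QSigma.instIsGalois (S : Finset Nat.Primes) : IsGalois ℚ (QSigma S) where

variable (p : ℕ) (F : Type*) [Field F] [Algebra ℚ F]

/-- `ℚ(μ_{p^∞})`, as a subfield of an extension `F` of `ℚ`. -/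
def Qmu : IntermediateField ℚ F :=
  IntermediateField.adjoin ℚ {x : F | ∃ n : ℕ, x ^ p ^ n = 1}

instance Qmu.instNormal [Normal ℚ F] : Normal ℚ (Qmu p F) := by
  rw [IntermediateField.normal_iff_forall_map_le']
  intro σ
  rw [IntermediateField.map_le_iff_le_comap, Qmu, IntermediateField.adjoin_le_iff]
  rintro x ⟨n, hn⟩
  exact IntermediateField.subset_adjoin _ _ ⟨n, by simp [← map_pow, hn]⟩

instance Qmu.instIsGalois [IsGalois ℚ F] : IsGalois ℚ (Qmu p F) where

/-- The torsion subgroup of `Γ' = Gal(ℚ(μ_{p^∞})/ℚ)`. For `p` odd, `Γ' ≃ ℤ_p^×` and this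
corresponds to `μ_{p-1}`. -/
def torsion : Subgroup Gal(Qmu p F/ℚ) :=
  Subgroup.closure {σ | IsOfFinOrder σ}

instance torsion.instNormal : (torsion p F).Normal where
  conj_mem n hn g := by
    have h1 : n ∈ (torsion p F).comap (MulAut.conj g).toMonoidHom := by
      refine (Subgroup.closure_le _).2 ?_ hn
      intro σ hσ
      exact Subgroup.subset_closure ((MulAut.conj g).toMonoidHom.isOfFinOrder hσ)
    exact h1

/-- For `p` odd, the cyclotomic `ℤ_p`-extension `ℚ^cyc` of `ℚ` as a subfield of `ℚ(μ_{p^∞})`: the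
fixed field of the torsion subgroup of `Gal(ℚ(μ_{p^∞})/ℚ) ≃ ℤ_p^×`. -/
def QcycIn : IntermediateField ℚ (Qmu p F) :=
  IntermediateField.fixedField (torsion p F)

instance QcycIn.instIsGalois [IsGalois ℚ F] : IsGalois ℚ (QcycIn p F) :=
  inferInstanceAs (IsGalois ℚ (IntermediateField.fixedField (torsion p F)))

/-- For `p` odd, the cyclotomic `ℤ_p`-extension `ℚ^cyc` of `ℚ` as a subfield of `F`. -/
def Qcyc : IntermediateField ℚ F := IntermediateField.lift (QcycIn p F)

instance Qcyc.instIsGalois [IsGalois ℚ F] : IsGalois ℚ (Qcyc p F) :=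
  IsGalois.of_algEquiv (IntermediateField.liftAlgEquiv (QcycIn p F))

/-- `Δ = Gal(ℚ(μ_{p^∞})/ℚ^cyc)`, the kernel of `Γ' → Γ`. -/
def Delta : Subgroup Gal(Qmu p F/ℚ) := (QcycIn p F).fixingSubgroup

instance Delta.instNormal [IsGalois ℚ F] : (Delta p F).Normal :=
  inferInstanceAs ((QcycIn p F).fixingSubgroup).Normal

end Fields

/-! ### Localization at a place above `l` -/

section Localization

variable {k K F : Type*} [Field k] [Field K] [Algebra k K] [Algebra ℚ k] [Algebra ℚ K]
  [IsScalarTower ℚ k K] [Field F] [Algebra ℚ F]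

/-- The restriction `Gal(K/k) → Gal(F/ℚ)` along an embedding `τ : F → K` of the normal extension
`F/ℚ`. -/
def restrictAlong [Normal ℚ F] (τ : F →ₐ[ℚ] K) : Gal(K/k) →* Gal(F/ℚ) :=
  letI : Algebra F K := τ.toRingHom.toAlgebra
  haveI : IsScalarTower ℚ F K := .of_algebraMap_eq fun x => (τ.commutes x).symm
  (AlgEquiv.restrictNormalHom F).comp (AlgEquiv.restrictScalarsHom ℚ)

theorem restrictAlong_commutes [Normal ℚ F] (τ : F →ₐ[ℚ] K) (σ : Gal(K/k)) (x : F) :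
    τ (restrictAlong τ σ x) = σ (τ x) := by
  let : Algebra F K := τ.toRingHom.toAlgebra
  have : IsScalarTower ℚ F K := .of_algebraMap_eq fun x => (τ.commutes x).symm
  exact AlgEquiv.restrictNormal_commutes (σ.restrictScalars ℚ) F x

variable (k) in
/-- The completion `L_w` of `L ⊆ F` at the place `w` cut out by `τ : F → K = ℚ̄_l` (with
`k = ℚ_l`): the field `ℚ_l(τ(L))`, which is the union of the completions of the finite
subextensions of `L`. -/
def localField (L : IntermediateField ℚ F) (τ : F →ₐ[ℚ] K) : IntermediateField k K :=
  IntermediateField.adjoin k (τ '' (L : Set F))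

theorem restrictAlong_mem [Normal ℚ F] (L : IntermediateField ℚ F) (τ : F →ₐ[ℚ] K) (σ : Gal(K/k))
    (hσ : σ ∈ (localField k L τ).fixingSubgroup) : restrictAlong τ σ ∈ L.fixingSubgroup := by
  rw [IntermediateField.mem_fixingSubgroup_iff] at hσ ⊢
  intro x hx
  refine τ.injective ((restrictAlong_commutes τ σ x).trans ?_)
  exact hσ _ (IntermediateField.subset_adjoin _ _ ⟨x, hx, rfl⟩)

variable (k) in
/-- The restriction `Gal(K/L_w) → Gal(F/L)`. -/
def localRes [Normal ℚ F] (L : IntermediateField ℚ F) (τ : F →ₐ[ℚ] K) :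
    (localField k L τ).fixingSubgroup →* L.fixingSubgroup :=
  ((restrictAlong τ).comp (Subgroup.subtype _)).codRestrict L.fixingSubgroup
    fun σ => restrictAlong_mem L τ σ.1 σ.2

theorem continuous_restrictAlong [Normal ℚ F] (τ : F →ₐ[ℚ] K) :
    Continuous (restrictAlong τ : Gal(K/k) →* Gal(F/ℚ)) := by
  apply continuous_of_continuousAt_one _ (continuousAt_def.mpr _)
  intro N hN
  rw [map_one, krullTopology_mem_nhds_one_iff] at hN
  obtain ⟨L', hfin, hO⟩ := hN
  have hfg : FiniteDimensional k (localField k L' τ) := by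
    let b := Module.finBasis ℚ L'
    have h : localField k L' τ =
        IntermediateField.adjoin k (Set.range fun i => τ (b i : F)) := by
      apply le_antisymm
      · refine IntermediateField.adjoin_le_iff.2 ?_
        rintro _ ⟨x, hx, rfl⟩
        have e := congrArg (fun y : L' => τ (y : F)) (b.sum_repr ⟨x, hx⟩)
        simp only [AddSubmonoidClass.coe_finsetSum, map_sum, IntermediateField.coe_smul,
          map_smul] at e
        rw [← e]
        refine sum_mem fun i _ => ?_
        rw [Algebra.smul_def, IsScalarTower.algebraMap_apply ℚ k K]
        exact mul_mem (IntermediateField.algebraMap_mem _ _)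
          (IntermediateField.subset_adjoin _ _ ⟨i, rfl⟩)
      · refine IntermediateField.adjoin.mono _ _ _ ?_
        rintro _ ⟨i, rfl⟩
        exact ⟨_, (b i).2, rfl⟩
    rw [h]
    refine IntermediateField.finiteDimensional_adjoin ?_
    rintro _ ⟨i, rfl⟩
    have h1 : IsIntegral ℚ (b i : F) := (Algebra.IsIntegral.isIntegral (b i)).map L'.val
    exact (h1.map τ).tower_top
  refine (krullTopology_mem_nhds_one_iff _ _ _).2 ⟨localField k L' τ, hfg, fun σ hσ => ?_⟩
  exact hO (restrictAlong_mem L' τ σ hσ)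

theorem continuous_localRes [Normal ℚ F] (L : IntermediateField ℚ F) (τ : F →ₐ[ℚ] K) :
    Continuous (localRes k L τ) :=
  Continuous.subtype_mk ((continuous_restrictAlong τ).comp continuous_subtype_val) _

end Localization

/-! ### Points of elliptic curves and Selmer groups -/

section Selmer

open WeierstrassCurve

/-- The group `E(F)`. -/
abbrev Pt (E : WeierstrassCurve ℚ) (F : Type*) [Field F] [Algebra ℚ F] : Type _ :=
  (E.baseChange F).toAffine.Point

open scoped Classical in
instance Pt.instAddCommGroup (E : WeierstrassCurve ℚ) (F : Type*) [Field F] [Algebra ℚ F] :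
    AddCommGroup (Pt E F) :=
  inferInstanceAs (AddCommGroup (E.baseChange F).toAffine.Point)

open scoped Classical in
/-- The homomorphism `E(F) → E(K)` induced by an embedding `F → K`. -/
def Pt.map (E : WeierstrassCurve ℚ) {F K : Type*} [Field F] [Algebra ℚ F] [Field K] [Algebra ℚ K]
    (f : F →ₐ[ℚ] K) : Pt E F →+ Pt E K :=
  Affine.Point.map (W' := E.toAffine) f

theorem Pt.map_comp (E : WeierstrassCurve ℚ) {F K L : Type*} [Field F] [Algebra ℚ F] [Field K]
    [Algebra ℚ K] [Field L] [Algebra ℚ L] (f : F →ₐ[ℚ] K) (g : K →ₐ[ℚ] L) (P : Pt E F) :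
    Pt.map E (g.comp f) P = Pt.map E g (Pt.map E f P) := by
  classical
  cases P <;> rfl

/-- The Galois action on points. -/
instance Pt.instDistribMulAction (E : WeierstrassCurve ℚ) (k K : Type*) [Field k] [Field K]
    [Algebra k K] [Algebra ℚ k] [Algebra ℚ K] [IsScalarTower ℚ k K] :
    DistribMulAction Gal(K/k) (Pt E K) where
  smul σ P := Pt.map E ((σ.restrictScalars ℚ : K ≃ₐ[ℚ] K) : K →ₐ[ℚ] K) P
  one_smul P := by cases P <;> rfl
  mul_smul a b P := by cases P <;> rfl
  smul_zero _ := map_zero _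
  smul_add _ := map_add _

/-- `E_{p^∞}`: the Galois module of `p`-power torsion points of `E` over `F`. -/
def Ptor (E : WeierstrassCurve ℚ) (p : ℕ) (F : Type*) [Field F] [Algebra ℚ F] :
    AddSubgroup (Pt E F) where
  carrier := {P | ∃ n : ℕ, p ^ n • P = 0}
  zero_mem' := ⟨0, smul_zero _⟩
  add_mem' := by
    rintro a b ⟨m, hm⟩ ⟨n, hn⟩
    refine ⟨m + n, ?_⟩
    rw [smul_add, pow_add, mul_smul, mul_smul, hn, smul_comm, hm, smul_zero, smul_zero, add_zero]
  neg_mem' := by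
    rintro a ⟨m, hm⟩
    exact ⟨m, by rw [smul_neg, hm, neg_zero]⟩

instance Ptor.instDistribMulAction (E : WeierstrassCurve ℚ) (p : ℕ) (F : Type*) [Field F]
    [Algebra ℚ F] : DistribMulAction Gal(F/ℚ) (Ptor E p F) where
  smul σ P := ⟨σ • P.1, by
    obtain ⟨n, hn⟩ := P.2
    exact ⟨n, by rw [smul_comm, hn, smul_zero]⟩⟩
  one_smul P := Subtype.ext (one_smul _ P.1)
  mul_smul a b P := Subtype.ext (mul_smul a b P.1)
  smul_zero a := Subtype.ext (smul_zero a)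
  smul_add a b d := Subtype.ext (smul_add a b.1 d.1)

variable (E : WeierstrassCurve ℚ) (p : ℕ)

/-- The localization `H¹(Gal(F/L), E_{p^∞}) → H¹(L_w, E)`, with `w` the place of `L` cut out by
the embedding `τ : F → K`. -/
def locMap {k K F : Type*} [Field k] [Field K] [Algebra k K] [Algebra ℚ k] [Algebra ℚ K]
    [IsScalarTower ℚ k K] [Field F] [Algebra ℚ F] [Normal ℚ F]
    (L : IntermediateField ℚ F) (τ : F →ₐ[ℚ] K) :
    H1 L.fixingSubgroup (Ptor E p F) →+ H1 (localField k L τ).fixingSubgroup (Pt E K) :=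
  H1.map (localRes k L τ) (continuous_localRes L τ) ((Pt.map E τ).comp (Ptor E p F).subtype) (by
    intro σ P
    show Pt.map E τ (Pt.map E _ P.1) = Pt.map E _ (Pt.map E τ P.1)
    rw [← Pt.map_comp, ← Pt.map_comp]
    congr 1
    congr 1
    ext x
    exact restrictAlong_commutes τ σ.1 x)

variable (S : Finset Nat.Primes)

/-- The localization map `λ_Σ(L) : H¹(G_Σ(L), E_{p^∞}) → ∏_{l ∈ Σ} ∏_{w ∣ l} H¹(L_w, E)`, where
`G_Σ(L) = Gal(ℚ_Σ/L)`. The places `w ∣ l` of `L` are given by the embeddings `τ` of `ℚ_Σ`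
into `ℚ̄_l`; embeddings giving the same place have conjugate, hence equivalent, local conditions. -/
def lambda (L : IntermediateField ℚ (QSigma S)) :
    H1 L.fixingSubgroup (Ptor E p (QSigma S)) →+
      ∀ x : (Σ l : S, QSigma S →ₐ[ℚ] AlgebraicClosure ℚ_[(l.1 : ℕ)]),
        H1 (localField ℚ_[(x.1.1 : ℕ)] L x.2).fixingSubgroup
          (Pt E (AlgebraicClosure ℚ_[(x.1.1 : ℕ)])) :=
  AddMonoidHom.pi fun x => locMap E p L x.2

/-- The Selmer group `Sel(E/L) = ker λ_Σ(L)`. -/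
def Sel (L : IntermediateField ℚ (QSigma S)) :
    AddSubgroup (H1 L.fixingSubgroup (Ptor E p (QSigma S))) :=
  (lambda E p S L).ker

theorem locMap_mk_eq_zero_iff {k K F : Type*} [Field k] [Field K] [Algebra k K] [Algebra ℚ k]
    [Algebra ℚ K] [IsScalarTower ℚ k K] [Field F] [Algebra ℚ F] [Normal ℚ F]
    (L : IntermediateField ℚ F) (τ : F →ₐ[ℚ] K) (z : Z1 L.fixingSubgroup (Ptor E p F)) :
    locMap E p (k := k) L τ (z : H1 L.fixingSubgroup (Ptor E p F)) = 0 ↔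
      ∃ P : Pt E K, ∀ σ : (localField k L τ).fixingSubgroup,
        Pt.map E τ (z.1 (localRes k L τ σ)) = σ • P - P :=
  QuotientAddGroup.eq_zero_iff _

theorem locMap_smul_eq_zero {k K F : Type*} [Field k] [Field K] [Algebra k K] [Algebra ℚ k]
    [Algebra ℚ K] [IsScalarTower ℚ k K] [Field F] [Algebra ℚ F] [IsGalois ℚ F]
    (L : IntermediateField ℚ F) [IsGalois ℚ L] (τ : F →ₐ[ℚ] K) (g : Gal(F/ℚ))
    (c : H1 L.fixingSubgroup (Ptor E p F))
    (hc : locMap E p (k := k) L (τ.comp (g : F →ₐ[ℚ] F)) c = 0) :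
    locMap E p (k := k) L τ (g • c) = 0 := by
  induction c using QuotientAddGroup.induction_on with
  | H z =>
    obtain ⟨z', h1, h2⟩ := H1.smul_mk L.fixingSubgroup g z
    obtain ⟨P, hP⟩ := (locMap_mk_eq_zero_iff E p L _ z).1 hc
    rw [h1]
    refine (locMap_mk_eq_zero_iff E p L τ z').2 ⟨P, fun σ => ?_⟩
    have hσ : σ.1 ∈ (localField k L (τ.comp (g : F →ₐ[ℚ] F))).fixingSubgroup := by
      refine IntermediateField.fixingSubgroup_le ?_ σ.2
      refine IntermediateField.adjoin.mono _ _ _ ?_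
      rintro _ ⟨y, hy, rfl⟩
      refine ⟨g y, ?_, rfl⟩
      have := IntermediateField.normal_iff_forall_map_le'.1 (inferInstance : Normal ℚ L) g
      exact this ⟨y, hy, rfl⟩
    refine Eq.trans ?_ (hP ⟨σ.1, hσ⟩)
    have e : MulAut.conjNormal g⁻¹ (localRes k L τ σ) =
        localRes k L (τ.comp (g : F →ₐ[ℚ] F)) ⟨σ.1, hσ⟩ := by
      refine Subtype.ext (AlgEquiv.ext fun y => ?_)
      apply (τ.comp (g : F →ₐ[ℚ] F)).injective
      refine Eq.trans ?_ (restrictAlong_commutes _ _ _).symm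
      have e1 : (τ.comp (g : F →ₐ[ℚ] F))
          ((MulAut.conjNormal g⁻¹ (localRes k L τ σ)).1 y) =
            τ (g (g⁻¹ ((localRes k L τ σ).1 (g y)))) := by
        rw [MulAut.conjNormal_apply, inv_inv]
        rfl
      refine e1.trans ?_
      rw [← AlgEquiv.mul_apply, mul_inv_cancel, AlgEquiv.one_apply]
      exact restrictAlong_commutes τ σ.1 (g y)
    rw [h2, e, Pt.map_comp]
    rfl

/-- The Selmer group is stable under the action of `Gal(ℚ_Σ/ℚ)` if `L/ℚ` is Galois. -/
theorem Sel.smul_mem (L : IntermediateField ℚ (QSigma S)) [IsGalois ℚ L] (g : Gal(QSigma S/ℚ))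
    (c : H1 L.fixingSubgroup (Ptor E p (QSigma S))) (hc : c ∈ Sel E p S L) :
    g • c ∈ Sel E p S L :=
  funext fun x => locMap_smul_eq_zero E p L x.2 g c (congrFun (AddMonoidHom.mem_ker.1 hc)
    ⟨x.1, x.2.comp (g : QSigma S →ₐ[ℚ] QSigma S)⟩)

instance Sel.instDistribMulAction (L : IntermediateField ℚ (QSigma S)) [IsGalois ℚ L] :
    DistribMulAction Gal(QSigma S/ℚ) (Sel E p S L) where
  smul g c := ⟨g • c.1, Sel.smul_mem E p S L g c.1 c.2⟩
  one_smul c := Subtype.ext (one_smul _ c.1)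
  mul_smul a b c := Subtype.ext (mul_smul a b c.1)
  smul_zero a := Subtype.ext (smul_zero a)
  smul_add a b c := Subtype.ext (smul_add a b.1 c.1)

theorem Sel.smul_of_restrict_eq_one (L : IntermediateField ℚ (QSigma S)) [IsGalois ℚ L]
    (g : Gal(QSigma S/ℚ)) (hg : AlgEquiv.restrictNormalHom L g = 1) (c : Sel E p S L) :
    g • c = c :=
  Subtype.ext (H1.smul_of_mem L.fixingSubgroup g
    (by rw [← IntermediateField.restrictNormalHom_ker]; exact hg) c.1)

/-- The `Gal(L/ℚ)`-module structure on `Sel(E/L)`: an automorphism of `L` acts as any of its lifts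
to `ℚ_Σ`. -/
instance Sel.instGal (L : IntermediateField ℚ (QSigma S)) [IsGalois ℚ L] :
    DistribMulAction Gal(L/ℚ) (Sel E p S L) :=
  descend (AlgEquiv.restrictNormalHom (F := ℚ) (K₁ := QSigma S) L)
    (AlgEquiv.restrictNormalHom_surjective (QSigma S)) (Sel.smul_of_restrict_eq_one E p S L)

theorem Sel.restrict_smul (L : IntermediateField ℚ (QSigma S)) [IsGalois ℚ L]
    (g : Gal(QSigma S/ℚ)) (c : Sel E p S L) :
    AlgEquiv.restrictNormalHom (F := ℚ) (K₁ := QSigma S) L g • c = g • c :=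
  descend_smul (AlgEquiv.restrictNormalHom (F := ℚ) (K₁ := QSigma S) L)
    (AlgEquiv.restrictNormalHom_surjective (QSigma S)) (Sel.smul_of_restrict_eq_one E p S L) g c

end Selmer

/-! ### Reduction types -/

section Reduction

/-- `E` has good reduction at `l`: a minimal Weierstrass equation of `E` over `ℚ_l` has good
reduction. -/
def GoodAt (E : WeierstrassCurve ℚ) (l : ℕ) [Fact l.Prime] : Prop :=
  ((E.baseChange ℚ_[l]).minimal ℤ_[l]).HasGoodReduction ℤ_[l]

/-- The trace of Frobenius `a_l(E) = l + 1 - #Ẽ(𝔽_l)` at a prime of good reduction. -/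
def ap (E : WeierstrassCurve ℚ) (l : ℕ) [Fact l.Prime] : ℤ :=
  l + 1 - Nat.card (((E.baseChange ℚ_[l]).minimal ℤ_[l]).reduction ℤ_[l]).toAffine.Point

/-- `E` has good ordinary reduction at `l`: good reduction with `l ∤ a_l(E)`. -/
def GoodOrdinaryAt (E : WeierstrassCurve ℚ) (l : ℕ) [Fact l.Prime] : Prop :=
  GoodAt E l ∧ ¬ (l : ℤ) ∣ ap E l

end Reduction

end TruncatedEuler

end

/-!
Write `F = ℚ_Σ`, `M = E_{p^∞}`, `Γ' = Gal(ℚ(μ_{p^∞})/ℚ)`, `D = Sel(E/ℚ(μ_{p^∞}))`. The comparison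
rests on `Δ` being finite of order prime to `p`: it has no cohomology in `p`-primary modules.

* *The tower.* `F` contains `μ_{p^∞}` because `p ∈ Σ` (`QSigma.exists_isPrimitiveRoot`). An element
  of finite order of `Γ'` is determined by its action on `μ_p` by lifting the exponent
  (`Qmu.eq_one_of_isOfFinOrder`), so the torsion of `Γ'` is finite of order prime to `p`; being
  closed, it equals `Δ` (`Delta_eq_torsion`, `Delta.card_coprime`).
* *Selmer groups.* The kernel of restriction `H¹(ℚ^cyc, M) → H¹(ℚ(μ_{p^∞}), M)` is killed both by
  `|Δ|` and by powers of `p`, hence is zero, and corestriction shows that its image consists of the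
  `Δ`-invariant classes (`H1.res_injective`, `H1.exists_res_eq`). Local conditions descend for the
  same reason (`locMap_eq_zero_iff_res`). Hence `Sel(E/ℚ^cyc) ≃ D^Δ`, equivariantly, and both have
  the same truncated `Γ`-Euler characteristic (`chi_Sel_Qcyc`).
* *The map `ψ`.* The group `D` is a discrete `p`-primary `Γ'`-module (`Sel.isOpen_stabilizer`,
  `Sel.exists_pow_nsmul_eq_zero`). Inflation `H¹(Γ'/Δ, D^Δ) → H¹(Γ', D)` is bijective because
  `H¹(Δ, D) = 0` (`inflation_surjective`), and evaluation at `γ` is bijective because `Γ'/Δ` is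
  procyclic and has open subgroups of index divisible by arbitrarily large powers of `p`
  (`evalAt_injective`, `evalAt_surjective`, `exists_isOpen_pow_dvd`). So `ψ_D` is `φ_{D^Δ}` up to
  isomorphisms, with the same kernel and cokernel (`chiG_eq_chi`).
-/

noncomputable section

namespace TruncatedEuler

/-! ### Kernels and cokernels -/

section Transport

/-- An isomorphism of two-term complexes induces bijections on kernels and on cokernels. -/
theorem ker_coker_congr {A B A' B' : Type*} [AddCommGroup A] [AddCommGroup B] [AddCommGroup A']
    [AddCommGroup B'] (f : A →+ B) (f' : A' →+ B') (a : A ≃+ A') (b : B ≃+ B')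
    (h : ∀ x, f' (a x) = b (f x)) :
    Nonempty (f.ker ≃ f'.ker) ∧ Nonempty (B ⧸ f.range ≃ B' ⧸ f'.range) := by
  refine ⟨⟨a.toEquiv.subtypeEquiv fun x => ?_⟩,
    ⟨(QuotientAddGroup.congr f.range f'.range b ?_).toEquiv⟩⟩
  · simp [AddMonoidHom.mem_ker, h]
  · ext y
    simp only [AddSubgroup.mem_map, AddMonoidHom.mem_range]
    constructor
    · rintro ⟨_, ⟨x, rfl⟩, rfl⟩
      exact ⟨a x, h x⟩
    · rintro ⟨x, rfl⟩
      exact ⟨_, ⟨a.symm x, rfl⟩, by simpa using (h (a.symm x)).symm⟩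

/-- The truncated Euler characteristic only depends on the image of the group in the automorphisms
of the module. -/
theorem chi_congr {Γ Γ₂ D D₂ : Type*} [Group Γ] [Group Γ₂] [AddCommGroup D] [AddCommGroup D₂]
    [DistribMulAction Γ D] [DistribMulAction Γ₂ D₂] (e : D ≃+ D₂)
    (h₁ : ∀ g : Γ, ∃ g' : Γ₂, ∀ d, e (g • d) = g' • e d)
    (h₂ : ∀ g' : Γ₂, ∃ g : Γ, ∀ d, e (g • d) = g' • e d) :
    (HasFiniteChi Γ D ↔ HasFiniteChi Γ₂ D₂) ∧ chi Γ D = chi Γ₂ D₂ := by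
  have hmem : ∀ d, d ∈ H0 Γ D ↔ e d ∈ H0 Γ₂ D₂ := by
    intro d
    constructor
    · intro hd g'
      obtain ⟨g, hg⟩ := h₂ g'
      rw [← hg, hd g]
    · intro hd g
      obtain ⟨g', hg⟩ := h₁ g
      exact e.injective ((hg d).trans (hd g'))
  let a : H0 Γ D ≃+ H0 Γ₂ D₂ :=
    { e.toEquiv.subtypeEquiv hmem with map_add' := fun x y => Subtype.ext (map_add e x.1 y.1) }
  let b : Coinv Γ D ≃+ Coinv Γ₂ D₂ := QuotientAddGroup.congr _ _ e (by
    rw [AddMonoidHom.map_closure]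
    congr 1
    ext y
    constructor
    · rintro ⟨_, ⟨g, d, rfl⟩, rfl⟩
      obtain ⟨g', hg⟩ := h₁ g
      exact ⟨g', e d, by simp [hg]⟩
    · rintro ⟨g', d, rfl⟩
      obtain ⟨g, hg⟩ := h₂ g'
      exact ⟨_, ⟨g, e.symm d, rfl⟩, by simp [hg]⟩)
  obtain ⟨⟨hk⟩, ⟨hc⟩⟩ := ker_coker_congr (phi Γ D) (phi Γ₂ D₂) a b fun x => rfl
  refine ⟨and_congr hk.finite_iff hc.finite_iff, ?_⟩
  rw [chi, chi, Nat.card_congr hk, Nat.card_congr hc]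

/-- If evaluation at `γ` and inflation are bijective, then `χ_t(G, D) = χ_t(G/H, D^H)`. -/
theorem chiG_eq_chi {G : Type*} [Group G] [TopologicalSpace G] (H : Subgroup G) [H.Normal]
    (D : Type*) [AddCommGroup D] [DistribMulAction G D] (γ : G ⧸ H)
    (hev : Function.Bijective (evalAt (H0 H D) γ)) (hinf : Function.Bijective (inflation H D)) :
    (HasFiniteChi (G ⧸ H) (H0 H D) ↔ HasFiniteChiG H D γ) ∧
      chi (G ⧸ H) (H0 H D) = chiG H D γ := by
  obtain ⟨⟨hk⟩, ⟨hc⟩⟩ := ker_coker_congr (phi (G ⧸ H) (H0 H D)) (psi H D γ) (AddEquiv.refl _)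
    ((AddEquiv.ofBijective _ hev).symm.trans (AddEquiv.ofBijective _ hinf)) (fun x => by
      simp [psi, coinvToH1, hev])
  refine ⟨and_congr hk.finite_iff hc.finite_iff, ?_⟩
  rw [chi, chiG, Nat.card_congr hk, Nat.card_congr hc]

end Transport

/-! ### Cocycles and finite quotients of order prime to `p` -/

section Cocycles

/-- Classes in `H¹` are represented by cocycles, and vanish exactly for coboundaries. -/
theorem H1.mk_eq_mk_iff {G M : Type*} [Group G] [TopologicalSpace G] [AddCommGroup M]
    [DistribMulAction G M] (z w : Z1 G M) :
    (z : H1 G M) = w ↔ ∃ m : M, ∀ g, w.1 g = z.1 g + (g • m - m) := by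
  rw [QuotientAddGroup.eq]
  refine exists_congr fun m => forall_congr' fun g => ?_
  simp only [AddSubgroup.coe_add, AddSubgroup.coe_neg, Pi.add_apply, Pi.neg_apply]
  rw [neg_add_eq_iff_eq_add]

theorem H1.mk_eq_zero_iff {G M : Type*} [Group G] [TopologicalSpace G] [AddCommGroup M]
    [DistribMulAction G M] (z : Z1 G M) :
    (z : H1 G M) = 0 ↔ ∃ m : M, ∀ g, z.1 g = g • m - m :=
  QuotientAddGroup.eq_zero_iff _

theorem Z1.map_one {G M : Type*} [Group G] [TopologicalSpace G] [AddCommGroup M]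
    [DistribMulAction G M] (z : Z1 G M) : z.1 1 = 0 := by
  have := z.2.2 1 1
  rwa [one_mul, one_smul, left_eq_add] at this

variable {A M : Type*} [Group A] [AddCommGroup M] [DistribMulAction A M]

/-- A cocycle whose restriction to the kernel of a homomorphism to a finite group `Q` is a
coboundary becomes a coboundary after multiplication by the order of `Q`. -/
theorem exists_card_nsmul_eq_coboundary {Q : Type*} [Group Q] [Finite Q] (φ : A →* Q) (z : A → M)
    (hz : ∀ g h, z (g * h) = z g + g • z h) (hker : ∃ m, ∀ g, φ g = 1 → z g = g • m - m) :
    ∃ m, ∀ g, Nat.card Q • z g = g • m - m := by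
  classical
  obtain ⟨m₀, hm₀⟩ := hker
  set w : A → M := fun g => z g - (g • m₀ - m₀) with hw
  have hwz : ∀ g h, w (g * h) = w g + g • w h := by
    intro g h
    simp only [hw, hz, mul_smul, smul_sub]
    abel
  have hw1 : ∀ g, φ g = 1 → w g = 0 := fun g hg => by simp [hw, hm₀ g hg]
  have hwk : ∀ g h, φ g = φ h → w g = w h := by
    intro g h hgh
    have h1 : w (g⁻¹ * h) = 0 := hw1 _ (by simp [hgh])
    have h2 := hwz g (g⁻¹ * h)
    rw [mul_inv_cancel_left, h1, smul_zero, add_zero] at h2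
    exact h2.symm
  let R := φ.range
  have : Fintype R := Fintype.ofFinite _
  -- Summing `w (g * s q) = w g + g • w (s q)` over the range of `φ` makes `card R • w` a coboundary.
  let s : R → A := fun q => q.2.choose
  have hs : ∀ q : R, φ (s q) = q := fun q => q.2.choose_spec
  have key : ∀ g, Nat.card R • w g = g • (-∑ q, w (s q)) - (-∑ q, w (s q)) := by
    intro g
    have h1 : ∑ q, w (g * s q) = ∑ q, w (s q) := by
      rw [← Equiv.sum_comp (Equiv.mulLeft (⟨φ g, g, rfl⟩ : R)) fun q => w (s q)]
      refine Finset.sum_congr rfl fun q _ => hwk _ _ ?_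
      rw [map_mul, hs, hs]
      rfl
    simp only [hwz, Finset.sum_add_distrib, Finset.sum_const, Finset.card_univ] at h1
    rw [Nat.card_eq_fintype_card, smul_neg, Finset.smul_sum, ← h1]
    abel
  obtain ⟨c, hc⟩ := Subgroup.card_subgroup_dvd_card R
  refine ⟨c • (-∑ q, w (s q)) + Nat.card Q • m₀, fun g => ?_⟩
  have h2 : z g = w g + (g • m₀ - m₀) := by simp [hw]
  rw [h2, smul_add, hc, mul_comm, mul_smul, key g]
  simp only [smul_add, smul_sub, smul_comm g, mul_smul]
  abel

/-- If two coprime multiples of a function are coboundaries, so is the function. -/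
theorem exists_eq_coboundary_of_coprime {a b : ℕ} (hab : a.Coprime b) (z : A → M)
    (ha : ∃ m, ∀ g, a • z g = g • m - m) (hb : ∃ m, ∀ g, b • z g = g • m - m) :
    ∃ m, ∀ g, z g = g • m - m := by
  obtain ⟨m, hm⟩ := ha
  obtain ⟨n, hn⟩ := hb
  refine ⟨a.gcdA b • m + a.gcdB b • n, fun g => ?_⟩
  have h1 : z g = (a * a.gcdA b + b * a.gcdB b : ℤ) • z g := by
    rw [← Nat.gcd_eq_gcd_ab, hab]
    simp
  rw [h1, add_smul, mul_comm, mul_smul, mul_comm (b : ℤ), mul_smul, natCast_zsmul, natCast_zsmul,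
    hm, hn]
  simp only [smul_add, smul_sub, smul_comm g]
  abel

end Cocycles

/-- Every element of a locally constant family of `p`-primary elements on a compact space is killed
by one power of `p`. -/
theorem exists_pow_nsmul_eq_zero {X M : Type*} [TopologicalSpace X] [CompactSpace X]
    [AddCommGroup M] (p : ℕ) (hM : ∀ m : M, ∃ n : ℕ, p ^ n • m = 0) (z : X → M)
    (hz : IsLocallyConstant z) : ∃ n : ℕ, ∀ x, p ^ n • z x = 0 := by
  choose n hn using hM
  obtain ⟨N, hN⟩ := (hz.range_finite.image n).bddAbove
  refine ⟨N, fun x => ?_⟩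
  obtain ⟨c, hc⟩ := Nat.exists_eq_add_of_le (hN ⟨z x, ⟨x, rfl⟩, rfl⟩)
  rw [hc, add_comm, pow_add, mul_smul, hn, smul_zero]

theorem H1.exists_pow_nsmul_eq_zero {G M : Type*} [Group G] [TopologicalSpace G] [CompactSpace G]
    [AddCommGroup M] [DistribMulAction G M] (p : ℕ) (hM : ∀ m : M, ∃ n : ℕ, p ^ n • m = 0)
    (c : H1 G M) : ∃ n : ℕ, p ^ n • c = 0 := by
  induction c using QuotientAddGroup.induction_on with
  | H z =>
    obtain ⟨n, hn⟩ := TruncatedEuler.exists_pow_nsmul_eq_zero p hM z.1 z.2.1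
    refine ⟨n, ?_⟩
    rw [← QuotientAddGroup.mk_nsmul]
    have : p ^ n • z = 0 := Subtype.ext (funext hn)
    rw [this]
    rfl

theorem exists_nsmul_eq_of_coprime {M : Type*} [AddCommGroup M] {p e : ℕ} (he : e.Coprime p)
    (hM : ∀ m : M, ∃ n : ℕ, p ^ n • m = 0) (m : M) : ∃ a : ℤ, e • a • m = m := by
  obtain ⟨n, hn⟩ := hM m
  refine ⟨e.gcdA (p ^ n), ?_⟩
  have h := Nat.gcd_eq_gcd_ab e (p ^ n)
  rw [(Nat.Coprime.pow_right n he : Nat.gcd e (p ^ n) = 1)] at h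
  rw [← natCast_zsmul, ← mul_smul]
  have h1 : (e * e.gcdA (p ^ n) : ℤ) • m
      = (e * e.gcdA (p ^ n) + (p ^ n : ℕ) * e.gcdB (p ^ n) : ℤ) • m := by
    rw [add_smul, mul_comm ((p ^ n : ℕ) : ℤ), mul_smul _ ((p ^ n : ℕ) : ℤ), natCast_zsmul, hn,
      smul_zero, add_zero]
  rw [h1, ← h]
  simp

theorem isLocallyConstant_smul {G M : Type*} [Group G] [TopologicalSpace G] [IsTopologicalGroup G]
    [AddCommGroup M] [DistribMulAction G M]
    (hopen : ∀ m : M, IsOpen (MulAction.stabilizer G m : Set G)) (m : M) :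
    IsLocallyConstant fun g : G => g • m := by
  refine (IsLocallyConstant.iff_exists_open _).2 fun g =>
    ⟨(fun x => g⁻¹ * x) ⁻¹' (MulAction.stabilizer G m : Set G),
      (hopen m).preimage (continuous_const_mul g⁻¹), by simp, fun x hx => ?_⟩
  rw [Set.mem_preimage, SetLike.mem_coe, MulAction.mem_stabilizer_iff, mul_smul,
    inv_smul_eq_iff] at hx
  exact hx

/-! ### Inflation from a quotient by a finite group of order prime to `p` -/

section Inflation

variable {G : Type*} [Group G] [TopologicalSpace G] (H : Subgroup G) [H.Normal]
  (D : Type*) [AddCommGroup D] [DistribMulAction G D]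

theorem inflation_injective : Function.Injective (inflation H D) := by
  rw [injective_iff_map_eq_zero]
  intro c hc
  induction c using QuotientAddGroup.induction_on with
  | H z =>
    obtain ⟨m, hm⟩ := (H1.mk_eq_zero_iff (Z1.map (QuotientGroup.mk' H) QuotientGroup.continuous_mk
      (H0 H D).subtype (fun g d => H0.mk_smul H D g d) z)).1 hc
    have hm' : ∀ g : G, ((z.1 (g : G ⧸ H) : H0 H D) : D) = g • m - m := hm
    have hmem : m ∈ H0 H D := by
      intro h
      have h1 := hm' h.1
      rw [(QuotientGroup.eq_one_iff _).2 h.2, Z1.map_one] at h1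
      exact (sub_eq_zero.1 h1.symm)
    refine (H1.mk_eq_zero_iff z).2 ⟨⟨m, hmem⟩, fun g => ?_⟩
    induction g using QuotientGroup.induction_on with
    | H g =>
      refine Subtype.ext ((hm' g).trans ?_)
      rw [AddSubgroup.coe_sub, H0.mk_smul]

/-- For `H` finite of order prime to `p` and `D` a discrete `p`-primary `G`-module, inflation
`H¹(G/H, D^H) → H¹(G, D)` is surjective, because `H¹(H, D) = 0`. -/
theorem inflation_surjective [IsTopologicalGroup G] [Finite H] {p : ℕ}
    (hH : (Nat.card H).Coprime p) (hD : ∀ d : D, ∃ n : ℕ, p ^ n • d = 0)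
    (hopen : ∀ d : D, IsOpen (MulAction.stabilizer G d : Set G)) :
    Function.Surjective (inflation H D) := by
  intro c
  induction c using QuotientAddGroup.induction_on with
  | H z =>
    obtain ⟨n, hn⟩ := exists_pow_nsmul_eq_zero p hD (fun h : H => z.1 h)
      (z.2.1.comp_continuous continuous_subtype_val)
    obtain ⟨m, hm⟩ := exists_eq_coboundary_of_coprime (A := H) (Nat.Coprime.pow_right n hH)
      (fun h : H => z.1 h)
      (exists_card_nsmul_eq_coboundary (MonoidHom.id H) (fun h : H => z.1 h)
        (fun g h => z.2.2 g h) ⟨0, fun g hg => by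
          have : g = 1 := hg
          simp [this, Z1.map_one]⟩)
      ⟨0, fun h => by simp [hn]⟩
    set w : G → D := fun g => z.1 g - (g • m - m) with hw
    have hwz : ∀ g h, w (g * h) = w g + g • w h := by
      intro g h
      simp only [hw, z.2.2, mul_smul, smul_sub]
      abel
    have hw1 : ∀ h : H, w h = 0 := fun h => sub_eq_zero.2 (hm h)
    have hwr : ∀ (g : G) (h : H), w (g * h) = w g := fun g h => by
      rw [hwz, hw1, smul_zero, add_zero]
    have hwl : ∀ (g : G) (h : H), (h : G) • w g = w g := fun g h => by
      have h1 := hwr g (MulAut.conjNormal g⁻¹ h)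
      rw [MulAut.conjNormal_apply, inv_inv, show g * (g⁻¹ * (h : G) * g) = h * g by group, hwz,
        hw1, zero_add] at h1
      exact h1
    have hwc : IsLocallyConstant w :=
      z.2.1.sub ((isLocallyConstant_smul hopen m).sub (IsLocallyConstant.const m))
    let v : G ⧸ H → H0 H D := Quotient.lift (fun g => ⟨w g, fun h => hwl g h⟩) (by
      intro g g' hgg
      refine Subtype.ext ?_
      have h1 := hwr g ⟨g⁻¹ * g', QuotientGroup.leftRel_apply.1 hgg⟩
      simpa using h1.symm)
    have hv : ∀ g : G, ((v (g : G ⧸ H) : H0 H D) : D) = w g := fun g => rfl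
    have hv1 : IsLocallyConstant v := by
      intro s
      rw [← (QuotientGroup.isQuotientMap_mk (N := H)).isOpen_preimage]
      convert hwc (Subtype.val '' s) using 1
      ext g
      simp only [Set.mem_preimage, Set.mem_image]
      constructor
      · exact fun h => ⟨_, h, hv g⟩
      · rintro ⟨x, hx, hxw⟩
        rwa [show v (g : G ⧸ H) = x from Subtype.ext ((hv g).trans hxw.symm)]
    have hv2 : ∀ g h, v (g * h) = v g + g • v h := by
      intro g h
      induction g using QuotientGroup.induction_on with
      | H g =>
        induction h using QuotientGroup.induction_on with
        | H h =>
          refine Subtype.ext ?_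
          rw [← QuotientGroup.mk_mul, hv, AddSubgroup.coe_add, H0.mk_smul, hv, hv, hwz]
    refine ⟨((⟨v, hv1, hv2⟩ : Z1 (G ⧸ H) (H0 H D)) : H1 (G ⧸ H) (H0 H D)), ?_⟩
    refine (H1.mk_eq_mk_iff (Z1.map (QuotientGroup.mk' H) QuotientGroup.continuous_mk
      (H0 H D).subtype (fun g d => H0.mk_smul H D g d) ⟨v, hv1, hv2⟩) z).2 ⟨m, fun g => ?_⟩
    exact (sub_eq_iff_eq_add.1 (hv g).symm)

end Inflation

/-! ### Evaluation of cocycles at a topological generator -/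

section PartialNorm

variable {Γ D : Type*} [Group Γ] [AddCommGroup D] [DistribMulAction Γ D]

/-- The partial norm `d + γ d + ⋯ + γ ^ (k - 1) d`. -/
def partialNorm (γ : Γ) (d : D) (k : ℕ) : D := ∑ i ∈ Finset.range k, γ ^ i • d

theorem partialNorm_add (γ : Γ) (d : D) (k l : ℕ) :
    partialNorm γ d (k + l) = partialNorm γ d k + γ ^ k • partialNorm γ d l := by
  simp only [partialNorm, Finset.sum_range_add, Finset.smul_sum, pow_add, mul_smul]

theorem partialNorm_mul {γ : Γ} {d : D} {m : ℕ} (h : γ ^ m • d = d) (k : ℕ) :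
    partialNorm γ d (m * k) = k • partialNorm γ d m := by
  have h1 : γ ^ m • partialNorm γ d m = partialNorm γ d m := by
    simp only [partialNorm, Finset.smul_sum]
    refine Finset.sum_congr rfl fun i _ => ?_
    rw [← mul_smul, ← pow_add, add_comm, pow_add, mul_smul, h]
  induction k with
  | zero => simp [partialNorm]
  | succ k ih =>
    rw [mul_add, mul_one, add_comm, partialNorm_add, ih, smul_comm, h1, succ_nsmul, add_comm]

end PartialNorm

section Evaluation

variable {Γ D : Type*} [Group Γ] [TopologicalSpace Γ] [AddCommGroup D] [DistribMulAction Γ D]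

theorem eq_zero_of_dense_zpowers [IsTopologicalGroup Γ] {γ : Γ}
    (hγ : Dense (Subgroup.zpowers γ : Set Γ)) (z : Z1 Γ D) (h : z.1 γ = 0) : z = 0 := by
  have hU : ∀ k : ℤ, z.1 (γ ^ k) = 0 := by
    let K : Subgroup Γ :=
      { carrier := {g | z.1 g = 0}
        one_mem' := Z1.map_one z
        mul_mem' := fun {a b} ha hb => by
          rw [Set.mem_ofPred_eq] at ha hb ⊢
          rw [z.2.2, ha, hb, smul_zero, add_zero]
        inv_mem' := fun {a} ha => by
          rw [Set.mem_ofPred_eq] at ha ⊢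
          have h1 := z.2.2 a⁻¹ a
          rwa [inv_mul_cancel, Z1.map_one, ha, smul_zero, add_zero, eq_comm] at h1 }
    exact fun k => K.zpow_mem (show γ ∈ K from h) k
  refine Subtype.ext (funext fun g => ?_)
  obtain ⟨x, hx, k, rfl⟩ := hγ.inter_open_nonempty _ (z.2.1 {z.1 g}) ⟨g, rfl⟩
  exact hx.symm.trans (hU k)

theorem exists_zpow_mem_coset [IsTopologicalGroup Γ] {γ : Γ}
    (hγ : Dense (Subgroup.zpowers γ : Set Γ)) {W : Subgroup Γ} (hW : IsOpen (W : Set Γ)) (g : Γ) :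
    ∃ k : ℤ, g⁻¹ * γ ^ k ∈ W := by
  obtain ⟨x, hx, k, rfl⟩ := hγ.inter_open_nonempty ((fun x => g⁻¹ * x) ⁻¹' (W : Set Γ))
    (hW.preimage (continuous_const_mul g⁻¹)) ⟨g, by simp [W.one_mem]⟩
  exact ⟨k, hx⟩

/-- The elements `g d - d` are multiples of `γ d - d`, since `g` acts on `d` as some power of the
topological generator `γ`. -/
theorem exists_smul_sub_eq [IsTopologicalGroup Γ] {γ : Γ}
    (hγ : Dense (Subgroup.zpowers γ : Set Γ))
    (hopen : ∀ d : D, IsOpen (MulAction.stabilizer Γ d : Set Γ)) {x : D}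
    (hx : x ∈ AddSubgroup.closure {x : D | ∃ (g : Γ) (d : D), x = g • d - d}) :
    ∃ m : D, x = γ • m - m := by
  let f : D →+ D := DistribSMul.toAddMonoidHom D γ - AddMonoidHom.id D
  suffices h : AddSubgroup.closure {x : D | ∃ (g : Γ) (d : D), x = g • d - d} ≤ f.range by
    obtain ⟨m, hm⟩ := h hx
    exact ⟨m, hm.symm⟩
  rw [AddSubgroup.closure_le]
  rintro _ ⟨g, d, rfl⟩
  obtain ⟨k, hk⟩ := exists_zpow_mem_coset hγ (hopen d) g
  have hk' : g • d = γ ^ k • d := by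
    rw [MulAction.mem_stabilizer_iff, mul_smul, inv_smul_eq_iff] at hk
    exact hk.symm
  rw [hk']
  let K : Subgroup Γ :=
    { carrier := {g | ∀ d : D, g • d - d ∈ f.range}
      one_mem' := fun d => by simp
      mul_mem' := fun {a b} ha hb d => by
        have := add_mem (ha (b • d)) (hb d)
        rwa [sub_add_sub_cancel, ← mul_smul] at this
      inv_mem' := fun {a} ha d => by
        have := neg_mem (ha (a⁻¹ • d))
        rwa [smul_inv_smul, neg_sub] at this }
  exact K.zpow_mem (show γ ∈ K from fun d => ⟨d, rfl⟩) k d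

theorem evalAt_injective [IsTopologicalGroup Γ] {γ : Γ}
    (hγ : Dense (Subgroup.zpowers γ : Set Γ))
    (hopen : ∀ d : D, IsOpen (MulAction.stabilizer Γ d : Set Γ)) :
    Function.Injective (evalAt D γ) := by
  rw [injective_iff_map_eq_zero]
  intro c hc
  induction c using QuotientAddGroup.induction_on with
  | H z =>
    obtain ⟨m, hm⟩ := exists_smul_sub_eq hγ hopen ((QuotientAddGroup.eq_zero_iff (z.1 γ)).1 hc)
    let b : Z1 Γ D := ⟨fun g => g • m - m,
      (isLocallyConstant_smul hopen m).sub (IsLocallyConstant.const m), fun g h => by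
        simp only [mul_smul, smul_sub]
        abel⟩
    have h0 := eq_zero_of_dense_zpowers hγ (z - b) (sub_eq_zero.2 hm)
    rw [sub_eq_zero.1 h0]
    exact (H1.mk_eq_zero_iff b).2 ⟨m, fun g => rfl⟩

/-- Evaluation at `γ` is surjective: for `d` fixed by `γ ^ m` and killed by `p ^ b`, the cocycle
`γ ^ k ↦ d + γ d + ⋯ + γ ^ (k - 1) d` only depends on `k` modulo `m p ^ b`, hence extends to `Γ`. -/
theorem evalAt_surjective [IsTopologicalGroup Γ] [CompactSpace Γ] {γ : Γ}
    (hγ : Dense (Subgroup.zpowers γ : Set Γ)) (hcomm : ∀ a b : Γ, a * b = b * a)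
    (hopen : ∀ d : D, IsOpen (MulAction.stabilizer Γ d : Set Γ)) {p : ℕ} [hp : Fact p.Prime]
    (hD : ∀ d : D, ∃ n : ℕ, p ^ n • d = 0)
    (hU : ∀ N : ℕ, ∃ U : Subgroup Γ, IsOpen (U : Set Γ) ∧ ∀ k : ℕ, γ ^ k ∈ U → p ^ N ∣ k) :
    Function.Surjective (evalAt D γ) := by
  intro c
  induction c using QuotientAddGroup.induction_on with
  | H d =>
    obtain ⟨b, hb⟩ := hD d
    set V := MulAction.stabilizer Γ d with hV
    have hVn : V.Normal := ⟨fun n hn g => by rwa [hcomm g n, mul_inv_cancel_right]⟩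
    have hVfin : Finite (Γ ⧸ V) := V.quotient_finite_of_isOpen (hopen d)
    set m := orderOf (γ : Γ ⧸ V) with hm
    have hm0 : 0 < m := orderOf_pos _
    have hmk : ∀ k : ℕ, γ ^ k ∈ V ↔ m ∣ k := fun k => by
      rw [hm, orderOf_dvd_iff_pow_eq_one, ← QuotientGroup.mk_pow, QuotientGroup.eq_one_iff]
    obtain ⟨a, m', hm', hma⟩ := Nat.exists_eq_pow_mul_and_not_dvd hm0.ne' p hp.out.ne_one
    -- For `m = p ^ a * m'` with `m'` prime to `p`, divisibility by `m` and by `p ^ (a + b)` together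
    -- give divisibility by `m * p ^ b`.
    obtain ⟨U, hUo, hUk⟩ := hU (a + b)
    set W := V ⊓ U with hW
    have hWo : IsOpen (W : Set Γ) := (hopen d).inter hUo
    have hWk : ∀ k : ℕ, γ ^ k ∈ W → m * p ^ b ∣ k := by
      intro k hk
      have h1 : m ∣ k := (hmk k).1 hk.1
      have h2 := hUk k hk.2
      have h3 : m * p ^ b = m' * p ^ (a + b) := by rw [hma, pow_add]; ring
      rw [h3]
      refine Nat.Coprime.mul_dvd_of_dvd_of_dvd ?_ ((Dvd.intro_left _ hma.symm).trans h1) h2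
      exact (Nat.Coprime.pow_left _ ((Nat.Prime.coprime_iff_not_dvd hp.out).2 hm')).symm
    have hnorm : ∀ k : ℕ, m * p ^ b ∣ k → partialNorm γ d k = 0 := by
      rintro _ ⟨j, rfl⟩
      rw [mul_assoc, partialNorm_mul ((hmk m).2 dvd_rfl), mul_comm, mul_smul]
      have : p ^ b • partialNorm γ d m = 0 := by
        simp only [partialNorm, Finset.smul_sum, smul_comm (p ^ b) _ d, hb, smul_zero,
          Finset.sum_const_zero]
      rw [this, smul_zero]
    have hle : ∀ k l : ℕ, k ≤ l → (γ ^ k)⁻¹ * γ ^ l ∈ W →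
        partialNorm γ d k = partialNorm γ d l := by
      intro k l hkl hmem
      obtain ⟨j, rfl⟩ := Nat.exists_eq_add_of_le hkl
      rw [pow_add, inv_mul_cancel_left] at hmem
      rw [partialNorm_add, hnorm j (hWk j hmem), smul_zero, add_zero]
    have hwd : ∀ k l : ℕ, (γ ^ k)⁻¹ * γ ^ l ∈ W → partialNorm γ d k = partialNorm γ d l := by
      intro k l hmem
      rcases le_total k l with h | h
      · exact hle k l h hmem
      · refine (hle l k h ?_).symm
        have := W.inv_mem hmem
        rwa [mul_inv_rev, inv_inv] at this
    have hWfin : Finite (Γ ⧸ W) := W.quotient_finite_of_isOpen hWo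
    have hex : ∀ g : Γ, ∃ k : ℕ, g⁻¹ * γ ^ k ∈ W := by
      intro g
      obtain ⟨k, hk⟩ := exists_zpow_mem_coset hγ hWo g
      obtain ⟨n, hn0, -, hn⟩ := Subgroup.exists_pow_mem_of_index_ne_zero
        (Subgroup.index_ne_zero_of_finite (H := W)) γ
      -- adding a multiple of `n` makes the exponent nonnegative without leaving the coset
      refine ⟨(k + n * k.natAbs).toNat, ?_⟩
      have h1 : 0 ≤ k + n * k.natAbs := by
        have : (1 : ℤ) * k.natAbs ≤ n * k.natAbs :=
          mul_le_mul_of_nonneg_right (by exact_mod_cast hn0) (by positivity)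
        omega
      rw [← zpow_natCast, Int.toNat_of_nonneg h1, zpow_add, ← mul_assoc]
      refine W.mul_mem hk ?_
      rw [zpow_mul, zpow_natCast, zpow_natCast]
      exact W.pow_mem hn _
    choose κ hκ using hex
    have hκ' : ∀ g k, g⁻¹ * γ ^ k ∈ W → partialNorm γ d (κ g) = partialNorm γ d k := by
      intro g k hk
      refine hwd _ _ ?_
      have := W.mul_mem (W.inv_mem (hκ g)) hk
      rwa [mul_inv_rev, inv_inv, mul_assoc, mul_inv_cancel_left] at this
    have hVi : ∀ v ∈ V, ∀ i : ℕ, v • γ ^ i • d = γ ^ i • d := by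
      intro v hv i
      rw [← mul_smul, hcomm, mul_smul, MulAction.mem_stabilizer_iff.1 hv]
    have hact : ∀ g l, γ ^ κ g • partialNorm γ d l = g • partialNorm γ d l := by
      intro g l
      have h1 : γ ^ κ g = g * (g⁻¹ * γ ^ κ g) := by group
      rw [h1, mul_smul]
      congr 1
      simp only [partialNorm, Finset.smul_sum]
      exact Finset.sum_congr rfl fun i _ => hVi _ (hκ g).1 i
    let z : Z1 Γ D := ⟨fun g => partialNorm γ d (κ g), by
      refine (IsLocallyConstant.iff_exists_open _).2 fun g =>
        ⟨(fun x => g⁻¹ * x) ⁻¹' (W : Set Γ), hWo.preimage (continuous_const_mul g⁻¹),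
          by simp [W.one_mem], fun x hx => (hκ' g _ ?_).symm⟩
      have := W.mul_mem hx (hκ x)
      rwa [mul_assoc, mul_inv_cancel_left] at this, by
      intro g h
      refine (hκ' (g * h) (κ g + κ h) ?_).trans (by rw [partialNorm_add, hact])
      have e : (g * h)⁻¹ * γ ^ (κ g + κ h) = g⁻¹ * γ ^ κ g * (h⁻¹ * γ ^ κ h) := by
        rw [pow_add, mul_inv_rev, hcomm h⁻¹ g⁻¹, mul_assoc, ← mul_assoc h⁻¹, hcomm h⁻¹]
        simp only [mul_assoc]
      rw [e]
      exact W.mul_mem (hκ g) (hκ h)⟩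
    refine ⟨(z : H1 Γ D), ?_⟩
    have h1 : z.1 γ = d := (hκ' γ 1 (by simp [W.one_mem])).trans (by simp [partialNorm])
    exact congrArg (QuotientAddGroup.mk (s := AddSubgroup.closure _)) h1

end Evaluation

/-! ### Discreteness of `H¹` -/

/-- For a closed normal subgroup `N` of a profinite group `G` and a discrete `G`-module `M`, the
`G`-module `H¹(N, M)` is discrete: a cocycle `z` is fixed by every open normal subgroup of `G` that
fixes the finitely many values of `z` and meets `N` inside the zero set of `z`. -/
theorem H1.isOpen_stabilizer {G : Type*} [Group G] [TopologicalSpace G] [IsTopologicalGroup G]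
    [CompactSpace G] [TotallyDisconnectedSpace G] (N : Subgroup G) [N.Normal]
    (hN : IsClosed (N : Set G)) {M : Type*} [AddCommGroup M] [DistribMulAction G M]
    (hopen : ∀ m : M, IsOpen (MulAction.stabilizer G m : Set G)) (c : H1 N M) :
    IsOpen (MulAction.stabilizer G c : Set G) := by
  induction c using QuotientAddGroup.induction_on with
  | H z =>
    have : CompactSpace N := isCompact_iff_compactSpace.1 hN.isCompact
    obtain ⟨A, hA, hAz⟩ := isOpen_induced_iff.1 (z.2.1 {0})
    have hfin : (Set.range z.1).Finite := z.2.1.range_finite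
    set B : Set G := A ∩ ⋂ m ∈ Set.range z.1, (MulAction.stabilizer G m : Set G) with hB
    have hBo : IsOpen B := hA.inter (hfin.isOpen_biInter fun m _ => hopen m)
    have hB1 : (1 : G) ∈ B := by
      refine ⟨?_, by simp⟩
      have : (1 : N) ∈ Subtype.val ⁻¹' A := by
        rw [hAz]
        exact Z1.map_one z
      exact this
    obtain ⟨U, hU⟩ := ProfiniteGrp.exist_openNormalSubgroup_sub_open_nhds_of_one hBo hB1
    refine Subgroup.isOpen_mono (H₁ := U.toSubgroup) (fun g hg => ?_) U.isOpen'
    rw [MulAction.mem_stabilizer_iff]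
    obtain ⟨z', h1, h2⟩ := H1.smul_mk N g z
    rw [h1]
    congr 1
    refine Subtype.ext (funext fun n => ?_)
    have h3 : MulAut.conjNormal g⁻¹ n = n * (n⁻¹ * MulAut.conjNormal g⁻¹ n) := by group
    have h4 : ((n⁻¹ * MulAut.conjNormal g⁻¹ n : N) : G) ∈ U.toSubgroup := by
      rw [Subgroup.coe_mul, MulAut.conjNormal_apply, inv_inv, ← mul_assoc, ← mul_assoc]
      refine U.toSubgroup.mul_mem ?_ hg
      have := U.isNormal'.conj_mem g⁻¹ (inv_mem hg) (n⁻¹ : G)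
      rwa [inv_inv] at this
    have h5 : z.1 (n⁻¹ * MulAut.conjNormal g⁻¹ n) = 0 := by
      have : (n⁻¹ * MulAut.conjNormal g⁻¹ n : N) ∈ Subtype.val ⁻¹' A := (hU h4).1
      rw [hAz] at this
      exact this
    have h6 : g • z.1 n = z.1 n := by
      have := (hU hg).2
      simp only [Set.mem_iInter] at this
      exact this _ ⟨n, rfl⟩
    rw [h2, h3, z.2.2, h5, smul_zero, add_zero, h6]

/-! ### Restriction to a subgroup of finite index prime to `p` -/

section Restriction

variable {G : Type*} [Group G] [TopologicalSpace G] {N₁ N₂ : Subgroup G} {M : Type*}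
  [AddCommGroup M] [DistribMulAction G M]

variable (M) in
/-- The restriction map `H¹(N₁, M) → H¹(N₂, M)` for subgroups `N₂ ≤ N₁` of `G`. -/
def H1.res (h : N₂ ≤ N₁) : H1 N₁ M →+ H1 N₂ M :=
  H1.map (Subgroup.inclusion h) (continuous_inclusion h) (AddMonoidHom.id M) fun _ _ => rfl

theorem H1.res_mk (h : N₂ ≤ N₁) (z : Z1 N₁ M) :
    ∃ z' : Z1 N₂ M, H1.res M h (z : H1 N₁ M) = (z' : H1 N₂ M) ∧
      ∀ n, z'.1 n = z.1 (Subgroup.inclusion h n) :=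
  ⟨_, rfl, fun _ => rfl⟩

theorem H1.res_smul [IsTopologicalGroup G] [N₁.Normal] [N₂.Normal] (h : N₂ ≤ N₁) (g : G)
    (c : H1 N₁ M) : H1.res M h (g • c) = g • H1.res M h c := by
  induction c using QuotientAddGroup.induction_on with
  | H z =>
    obtain ⟨z₁, h1, h1'⟩ := H1.smul_mk N₁ g z
    obtain ⟨z₂, h2, h2'⟩ := H1.res_mk h z
    obtain ⟨z₃, h3, h3'⟩ := H1.res_mk h z₁
    obtain ⟨z₄, h4, h4'⟩ := H1.smul_mk N₂ g z₂
    rw [h1, h3, h2, h4]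
    congr 1
    refine Subtype.ext (funext fun n => ?_)
    rw [h3', h1', h4', h2']
    rfl

theorem H1.res_injective [CompactSpace N₁] [N₂.Normal] (h : N₂ ≤ N₁)
    [Finite (N₁ ⧸ N₂.subgroupOf N₁)] {p : ℕ}
    (hcop : (Nat.card (N₁ ⧸ N₂.subgroupOf N₁)).Coprime p) (hM : ∀ m : M, ∃ n : ℕ, p ^ n • m = 0) :
    Function.Injective (H1.res M h) := by
  rw [injective_iff_map_eq_zero]
  intro c hc
  induction c using QuotientAddGroup.induction_on with
  | H z =>
    obtain ⟨z', h1, h1'⟩ := H1.res_mk h z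
    rw [h1] at hc
    obtain ⟨m, hm⟩ := (H1.mk_eq_zero_iff z').1 hc
    obtain ⟨n, hn⟩ := TruncatedEuler.exists_pow_nsmul_eq_zero p hM z.1 z.2.1
    refine (H1.mk_eq_zero_iff z).2 (exists_eq_coboundary_of_coprime (Nat.Coprime.pow_right n hcop)
      z.1 (exists_card_nsmul_eq_coboundary (QuotientGroup.mk' (N₂.subgroupOf N₁)) z.1 z.2.2
        ⟨m, fun g hg => ?_⟩) ⟨0, fun g => by simp [hn]⟩)
    have hg' : (g : G) ∈ N₂ := by
      rwa [QuotientGroup.mk'_apply, QuotientGroup.eq_one_iff, Subgroup.mem_subgroupOf] at hg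
    exact (h1' ⟨g, hg'⟩).symm.trans (hm _)

theorem isLocallyConstant_of_cocycle {A : Type*} [Group A] [TopologicalSpace A]
    [IsTopologicalGroup A] [DistribMulAction A M] {w : A → M}
    (hw : ∀ g h, w (g * h) = w g + g • w h) {U : Set A} (hU : IsOpen U) (h1 : 1 ∈ U)
    (h0 : ∀ g ∈ U, w g = 0) : IsLocallyConstant w :=
  (IsLocallyConstant.iff_exists_open _).2 fun g =>
    ⟨(fun x => g⁻¹ * x) ⁻¹' U, hU.preimage (continuous_const_mul g⁻¹), by simpa using h1,
      fun x hx => by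
        have := hw g (g⁻¹ * x)
        rwa [mul_inv_cancel_left, h0 _ hx, smul_zero, add_zero] at this⟩

/-- For a class `c ∈ H¹(N₂, M)` invariant under `N₁`, the restriction of the corestriction of `c`
is `(N₁ : N₂) • c`. -/
theorem H1.exists_res_eq_card_nsmul [IsTopologicalGroup G] [N₂.Normal] (h : N₂ ≤ N₁)
    [Finite (N₁ ⧸ N₂.subgroupOf N₁)] (hN : IsOpen (N₂.subgroupOf N₁ : Set N₁)) (c : H1 N₂ M)
    (hc : ∀ g ∈ N₁, g • c = c) :
    ∃ c' : H1 N₁ M, H1.res M h c' = Nat.card (N₁ ⧸ N₂.subgroupOf N₁) • c := by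
  induction c using QuotientAddGroup.induction_on with
  | H z =>
    let Q := N₁ ⧸ N₂.subgroupOf N₁
    have : Fintype Q := Fintype.ofFinite Q
    let s : Q → N₁ := Quotient.out
    have hs : ∀ q : Q, ((s q : N₁) : Q) = q := fun q => Quotient.out_eq q
    have hmem : ∀ (g : N₁) (q : Q), (((s (g • q))⁻¹ * g * s q : N₁) : G) ∈ N₂ := by
      intro g q
      rw [← Subgroup.mem_subgroupOf, mul_assoc, ← QuotientGroup.eq, hs]
      conv_lhs => rw [← hs q]
      rfl
    let ν : N₁ → Q → N₂ := fun g q => ⟨_, hmem g q⟩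
    have hν : ∀ g h q, ν (g * h) q = ν g (h • q) * ν h q := by
      intro g h q
      refine Subtype.ext ?_
      simp only [ν, mul_smul, Subgroup.coe_mul, Subgroup.coe_inv]
      group
    -- the corestriction of `z` with respect to the coset representatives `s`
    let w : N₁ → M := fun g => ∑ q, s (g • q) • z.1 (ν g q)
    have hw : ∀ g h, w (g * h) = w g + g • w h := by
      intro g h
      have h1 : w g = ∑ q, s (g • h • q) • z.1 (ν g (h • q)) :=
        (Equiv.sum_comp (MulAction.toPerm h) fun q => s (g • q) • z.1 (ν g q)).symm
      rw [h1, Finset.smul_sum, ← Finset.sum_add_distrib]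
      refine Finset.sum_congr rfl fun q _ => ?_
      rw [hν, z.2.2, smul_add, mul_smul]
      congr 1
      simp only [ν, Subgroup.smul_def, ← mul_smul, Subgroup.coe_mul, Subgroup.coe_inv]
      congr 1
      group
    have hfix : ∀ (g : N₁) (q : Q), (s q)⁻¹ * g * s q ∈ N₂.subgroupOf N₁ → g • q = q := by
      intro g q hg
      rw [mul_assoc, ← QuotientGroup.eq, hs] at hg
      conv_lhs => rw [← hs q]
      exact hg.symm
    let K : Set N₁ := Subgroup.inclusion h '' {n | z.1 n = 0}
    have hK : IsOpen K := by
      obtain ⟨A, hA, hAz⟩ := isOpen_induced_iff.1 (z.2.1 {0})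
      have : K = (N₂.subgroupOf N₁ : Set N₁) ∩ Subtype.val ⁻¹' A := by
        ext x
        constructor
        · rintro ⟨n, hn, rfl⟩
          refine ⟨n.2, ?_⟩
          have : n ∈ Subtype.val ⁻¹' A := by
            rw [hAz]
            exact hn
          exact this
        · rintro ⟨hx1, hx2⟩
          refine ⟨⟨x, hx1⟩, ?_, rfl⟩
          have : (⟨x, hx1⟩ : N₂) ∈ Subtype.val ⁻¹' A := hx2
          rw [hAz] at this
          exact this
      rw [this]
      exact hN.inter (hA.preimage continuous_subtype_val)
    have hwc : IsLocallyConstant w := by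
      refine isLocallyConstant_of_cocycle hw
        (U := ⋂ q, (fun g => (s q)⁻¹ * g * s q) ⁻¹' K)
        (isOpen_iInter_of_finite fun q => hK.preimage (by fun_prop)) ?_ fun g hg => ?_
      · simp only [Set.mem_iInter, Set.mem_preimage]
        intro q
        exact ⟨1, Z1.map_one z, by simp⟩
      · refine Finset.sum_eq_zero fun q _ => ?_
        obtain ⟨n, hn, hnq⟩ := Set.mem_iInter.1 hg q
        replace hnq : Subgroup.inclusion h n = (s q)⁻¹ * g * s q := hnq
        have h1 : g • q = q := hfix g q (by rw [← hnq]; exact n.2)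
        have h2 : ν g q = n := Subtype.ext (by
          simp only [ν, h1, ← hnq]
          rfl)
        rw [h2, hn, smul_zero]
    choose y hy hy' using fun q => H1.smul_mk N₂ (s q : G) z
    refine ⟨((⟨w, hwc, hw⟩ : Z1 N₁ M) : H1 N₁ M), ?_⟩
    obtain ⟨w', h1, h1'⟩ := H1.res_mk h (⟨w, hwc, hw⟩ : Z1 N₁ M)
    have h2 : w' = ∑ q, y q := by
      refine Subtype.ext (funext fun n => ?_)
      rw [h1', AddSubgroup.val_finsetSum, Finset.sum_apply]
      refine Finset.sum_congr rfl fun q _ => ?_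
      have h3 : Subgroup.inclusion h n • q = q := by
        refine hfix _ q ?_
        rw [Subgroup.mem_subgroupOf]
        have := ‹N₂.Normal›.conj_mem n n.2 (s q : G)⁻¹
        simpa using this
      rw [hy', h3]
      refine congrArg (fun x => (s q : G) • z.1 x) (Subtype.ext ?_)
      simp [ν, h3]
    have h4 : ((∑ q, y q : Z1 N₂ M) : H1 N₂ M) = ∑ q, (y q : H1 N₂ M) :=
      map_sum (QuotientAddGroup.mk' (B1 N₂ M)) _ _
    rw [h1, h2, h4, Nat.card_eq_fintype_card, ← Finset.card_univ, ← Finset.sum_const]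
    exact Finset.sum_congr rfl fun q _ => (hy q).symm.trans (hc _ (s q).2)

/-- Restriction to a subgroup of index prime to `p` is onto the invariant classes. -/
theorem H1.exists_res_eq [IsTopologicalGroup G] [CompactSpace N₂] [N₂.Normal] (h : N₂ ≤ N₁)
    [Finite (N₁ ⧸ N₂.subgroupOf N₁)] (hN : IsOpen (N₂.subgroupOf N₁ : Set N₁)) {p : ℕ}
    (hcop : (Nat.card (N₁ ⧸ N₂.subgroupOf N₁)).Coprime p) (hM : ∀ m : M, ∃ n : ℕ, p ^ n • m = 0)
    (c : H1 N₂ M) (hc : ∀ g ∈ N₁, g • c = c) : ∃ c' : H1 N₁ M, H1.res M h c' = c := by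
  obtain ⟨a, ha⟩ := exists_nsmul_eq_of_coprime (M := H1 N₂ M) hcop
    (H1.exists_pow_nsmul_eq_zero p hM) c
  obtain ⟨c', hc'⟩ := H1.exists_res_eq_card_nsmul h hN (a • c) fun g hg => by
    rw [smul_comm, hc g hg]
  exact ⟨c', hc'.trans ha⟩

end Restriction

/-! ### The cyclotomic tower -/

section Cyclotomic

variable {p : ℕ} [hp : Fact p.Prime]

theorem coprime_of_no_order {A : Type*} [Group A] [Finite A] (h : ∀ a : A, a ^ p = 1 → a = 1) :
    (Nat.card A).Coprime p := by
  refine (Nat.Coprime.symm ((Nat.Prime.coprime_iff_not_dvd hp.out).2 fun hdvd => ?_))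
  obtain ⟨a, ha⟩ := exists_prime_orderOf_dvd_card' p hdvd
  have h1 := h a (by rw [← ha, pow_orderOf_eq_one])
  rw [h1, orderOf_one] at ha
  exact hp.out.one_lt.ne ha

open NumberField in
/-- `ℚ_Σ` contains the `p`-power roots of unity if `p ∈ Σ`, as the discriminant of `ℚ(ζ_{p^n})` is
a power of `p` up to sign. -/
theorem QSigma.exists_isPrimitiveRoot {S : Finset Nat.Primes}
    (hpS : (⟨p, Fact.out⟩ : Nat.Primes) ∈ S) (n : ℕ) :
    ∃ ζ : QSigma S, IsPrimitiveRoot ζ (p ^ n) := by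
  obtain ⟨ζ, hζ⟩ := HasEnoughRootsOfUnity.exists_primitiveRoot (AlgebraicClosure ℚ) (p ^ n)
  let K : IntermediateField ℚ (AlgebraicClosure ℚ) := IntermediateField.adjoin ℚ {ζ}
  have hcyc : IsCyclotomicExtension {p ^ n} ℚ K :=
    hζ.intermediateField_adjoin_isCyclotomicExtension ℚ
  have hfin : FiniteDimensional ℚ K := IsCyclotomicExtension.finite_of_singleton (p ^ n) ℚ K
  have hnf : NumberField K := ⟨⟩
  have hK : K ≤ QSigma S := by
    refine le_sSup ⟨hfin, fun l hl => ?_⟩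
    have hlp : Prime ((l : ℕ) : ℤ) := Nat.prime_iff_prime_int.1 l.2
    refine (NumberField.not_dvd_discr_iff_isUnramifiedIn K (RingOfIntegers K) hlp).1 fun hdvd => hl ?_
    have hcyc' : @IsCyclotomicExtension {p ^ n} ℚ K _ _ DivisionRing.toRatAlgebra := by
      convert hcyc
      exact Subsingleton.elim _ _
    rw [IsCyclotomicExtension.Rat.discr_prime_pow p n K] at hdvd
    have h1 : ((l : ℕ) : ℤ) ∣ p := by
      rcases hlp.dvd_or_dvd hdvd with h | h
      · exact absurd (isUnit_of_dvd_unit (hlp.dvd_of_dvd_pow h) (by simp)) hlp.not_isUnit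
      · exact hlp.dvd_of_dvd_pow h
    have h2 : (l : ℕ) = p := (Nat.prime_dvd_prime_iff_eq l.2 hp.out).1 (by exact_mod_cast h1)
    rwa [show l = ⟨p, Fact.out⟩ from Subtype.ext h2]
  refine ⟨⟨ζ, hK (IntermediateField.mem_adjoin_simple_self ℚ ζ)⟩, ?_⟩
  exact IsPrimitiveRoot.of_map_of_injective (f := (QSigma S).val) hζ (QSigma S).val.injective

variable {F : Type*} [Field F] [Algebra ℚ F]

omit hp in
theorem Qmu.exists_isPrimitiveRoot (hF : ∀ n, ∃ ζ : F, IsPrimitiveRoot ζ (p ^ n)) (n : ℕ) :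
    ∃ ζ : Qmu p F, IsPrimitiveRoot ζ (p ^ n) := by
  obtain ⟨ζ, hζ⟩ := hF n
  refine ⟨⟨ζ, IntermediateField.subset_adjoin _ _ ⟨n, hζ.pow_eq_one⟩⟩, ?_⟩
  exact IsPrimitiveRoot.of_map_of_injective (f := (Qmu p F).val) hζ (Qmu p F).val.injective

omit hp in
theorem Qmu.gal_ext {σ τ : Gal(Qmu p F/ℚ)}
    (h : ∀ (x : Qmu p F) (n : ℕ), x ^ p ^ n = 1 → σ x = τ x) : σ = τ := by
  refine AlgEquiv.ext fun x => ?_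
  obtain ⟨x, hx⟩ := x
  refine IntermediateField.adjoin_induction (F := ℚ)
    (p := fun y hy => σ (⟨y, hy⟩ : Qmu p F) = τ ⟨y, hy⟩) ?_ ?_ ?_ ?_ ?_ hx
  · rintro y ⟨n, hn⟩
    exact h _ n (Subtype.ext hn)
  · intro q
    exact (σ.commutes q).trans (τ.commutes q).symm
  · intro a b ha hb h1 h2
    exact (map_add σ (⟨a, ha⟩ : Qmu p F) ⟨b, hb⟩).trans
      ((congrArg₂ (· + ·) h1 h2).trans (map_add τ (⟨a, ha⟩ : Qmu p F) ⟨b, hb⟩).symm)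
  · intro a ha h1
    exact (map_inv₀ σ (⟨a, ha⟩ : Qmu p F)).trans
      ((congrArg (·⁻¹) h1).trans (map_inv₀ τ (⟨a, ha⟩ : Qmu p F)).symm)
  · intro a b ha hb h1 h2
    exact (map_mul σ (⟨a, ha⟩ : Qmu p F) ⟨b, hb⟩).trans
      ((congrArg₂ (· * ·) h1 h2).trans (map_mul τ (⟨a, ha⟩ : Qmu p F) ⟨b, hb⟩).symm)

theorem Qmu.gal_ext_of_isPrimitiveRoot {σ τ : Gal(Qmu p F/ℚ)}
    (h : ∀ n, ∃ ζ : Qmu p F, IsPrimitiveRoot ζ (p ^ n) ∧ σ ζ = τ ζ) : σ = τ := by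
  refine Qmu.gal_ext fun x n hx => ?_
  obtain ⟨ζ, hζ, he⟩ := h n
  obtain ⟨i, -, rfl⟩ := hζ.eq_pow_of_pow_eq_one hx
  rw [map_pow, map_pow, he]

theorem pow_eq_pow_iff_modEq_of_isPrimitiveRoot {K : Type*} [Field K] {n : ℕ} [NeZero n] {ζ : K}
    (hζ : IsPrimitiveRoot ζ n) {i j : ℕ} : ζ ^ i = ζ ^ j ↔ i ≡ j [MOD n] := by
  conv_rhs => rw [hζ.eq_orderOf]
  exact (hζ.isOfFinOrder (NeZero.ne n)).pow_eq_pow_iff_modEq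

theorem exists_apply_eq_pow {K : Type*} [Field K] [Algebra ℚ K] (σ : Gal(K/ℚ)) {n : ℕ} [NeZero n]
    {ζ : K} (hζ : IsPrimitiveRoot ζ n) : ∃ a : ℕ, σ ζ = ζ ^ a := by
  obtain ⟨a, -, ha⟩ := hζ.eq_pow_of_pow_eq_one (ξ := σ ζ) (by rw [← map_pow, hζ.pow_eq_one, map_one])
  exact ⟨a, ha.symm⟩

theorem pow_apply_eq_pow {K : Type*} [Field K] [Algebra ℚ K] {σ : Gal(K/ℚ)} {ζ : K} {a : ℕ}
    (h : σ ζ = ζ ^ a) (k : ℕ) : (σ ^ k) ζ = ζ ^ a ^ k := by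
  induction k with
  | zero => simp
  | succ k ih => rw [pow_succ', AlgEquiv.mul_apply, ih, map_pow, h, ← pow_mul, pow_succ']

theorem Qmu.gal_comm (hF : ∀ n, ∃ ζ : F, IsPrimitiveRoot ζ (p ^ n)) (σ τ : Gal(Qmu p F/ℚ)) :
    σ * τ = τ * σ := by
  refine Qmu.gal_ext_of_isPrimitiveRoot fun n => ?_
  obtain ⟨ζ, hζ⟩ := Qmu.exists_isPrimitiveRoot hF n
  obtain ⟨a, ha⟩ := exists_apply_eq_pow σ hζ
  obtain ⟨b, hb⟩ := exists_apply_eq_pow τ hζ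
  refine ⟨ζ, hζ, ?_⟩
  rw [AlgEquiv.mul_apply, AlgEquiv.mul_apply, ha, hb, map_pow, map_pow, ha, hb, ← pow_mul,
    ← pow_mul, mul_comm]

/-- An automorphism of finite order of `ℚ(μ_{p^∞})` fixing `ζ_p` is trivial for odd `p`: if
`σ ^ m = 1` and `σ` acts on `μ_{p^N}` as `a`-th power, then `a ^ m ≡ 1` modulo `p ^ N`, and `a ≡ 1`
modulo `p ^ (N - v_p(m))` by lifting the exponent. -/
theorem Qmu.eq_one_of_isOfFinOrder (hodd : Odd p) (hF : ∀ n, ∃ ζ : F, IsPrimitiveRoot ζ (p ^ n))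
    {σ : Gal(Qmu p F/ℚ)} (hσ : IsOfFinOrder σ) {ζ₁ : Qmu p F} (hζ₁ : IsPrimitiveRoot ζ₁ p)
    (h1 : σ ζ₁ = ζ₁) : σ = 1 := by
  have : NeZero p := ⟨hp.out.ne_zero⟩
  obtain ⟨m, hm0, hm⟩ := isOfFinOrder_iff_pow_eq_one.1 hσ
  obtain ⟨v, hv⟩ : ∃ v : ℕ, emultiplicity p m = v :=
    ⟨_, (Nat.finiteMultiplicity_iff.2 ⟨hp.out.ne_one, hm0⟩).emultiplicity_eq_multiplicity⟩
  refine Qmu.gal_ext_of_isPrimitiveRoot fun n => ?_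
  obtain ⟨ζ, hζ⟩ := Qmu.exists_isPrimitiveRoot hF (n + v + 1)
  obtain ⟨a, ha⟩ := exists_apply_eq_pow σ hζ
  have hpos : 0 < p ^ (n + v + 1) := pow_pos hp.out.pos _
  have hζp : IsPrimitiveRoot (ζ ^ p ^ (n + v)) p := hζ.pow hpos (pow_succ _ _)
  have hap : a ≡ 1 [MOD p] := by
    obtain ⟨i, -, hi⟩ := hζ₁.eq_pow_of_pow_eq_one hζp.pow_eq_one
    have h2 : σ (ζ ^ p ^ (n + v)) = ζ ^ p ^ (n + v) := by rw [← hi, map_pow, h1]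
    rw [map_pow, ha, ← pow_mul, mul_comm, pow_mul] at h2
    conv_rhs at h2 => rw [← pow_one (ζ ^ p ^ (n + v))]
    rw [pow_eq_pow_iff_modEq_of_isPrimitiveRoot hζp] at h2
    exact h2
  have ham : a ^ m ≡ 1 [MOD p ^ (n + v + 1)] := by
    have h2 := pow_apply_eq_pow ha m
    rw [hm, AlgEquiv.one_apply] at h2
    conv_lhs at h2 => rw [← pow_one ζ]
    rw [pow_eq_pow_iff_modEq_of_isPrimitiveRoot hζ] at h2
    exact h2.symm
  have hap' : (p : ℤ) ∣ a - 1 := by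
    have := (Nat.modEq_iff_dvd.1 hap.symm)
    exact_mod_cast this
  have ham' : (p : ℤ) ^ (n + v + 1) ∣ a ^ m - 1 ^ m := by
    have := (Nat.modEq_iff_dvd.1 ham.symm)
    push_cast at this
    simpa using this
  have hna : ¬ (p : ℤ) ∣ a := by
    intro h
    have h3 : (p : ℤ) ∣ 1 := by simpa using dvd_sub h hap'
    exact (Nat.prime_iff_prime_int.1 hp.out).not_isUnit (isUnit_of_dvd_one h3)
  have hlte := Int.emultiplicity_pow_sub_pow hp.out hodd hap' hna m
  rw [hv] at hlte
  have h4 := le_emultiplicity_of_pow_dvd ham'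
  rw [hlte] at h4
  have h5 : (p : ℤ) ^ n ∣ a - 1 := by
    refine pow_dvd_of_le_emultiplicity ?_
    by_contra hlt
    rw [not_le] at hlt
    obtain ⟨u, hu⟩ := ENat.ne_top_iff_exists.1 hlt.ne_top
    rw [← hu] at hlt h4
    have h6 : u < n := by exact_mod_cast hlt
    have h7 : n + v + 1 ≤ u + v := by exact_mod_cast h4
    omega
  have hζn : IsPrimitiveRoot (ζ ^ p ^ (v + 1)) (p ^ n) :=
    hζ.pow hpos (by rw [← pow_add]; congr 1; omega)
  refine ⟨_, hζn, ?_⟩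
  have h6 : 1 ≡ a [MOD p ^ n] := Nat.modEq_iff_dvd.2 (by exact_mod_cast h5)
  rw [map_pow, ha, ← pow_mul, mul_comm, pow_mul, AlgEquiv.one_apply]
  conv_rhs => rw [← pow_one (ζ ^ p ^ (v + 1))]
  rw [pow_eq_pow_iff_modEq_of_isPrimitiveRoot hζn]
  exact h6.symm

theorem torsion.isOfFinOrder (hF : ∀ n, ∃ ζ : F, IsPrimitiveRoot ζ (p ^ n)) {σ : Gal(Qmu p F/ℚ)}
    (hσ : σ ∈ torsion p F) : IsOfFinOrder σ := by
  refine Subgroup.closure_induction (p := fun σ _ => IsOfFinOrder σ) (fun σ hσ => hσ)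
    IsOfFinOrder.one (fun σ τ _ _ h1 h2 => ?_) (fun σ _ h => h.inv) hσ
  exact (show Commute σ τ from Qmu.gal_comm hF σ τ).isOfFinOrder_mul h1 h2

theorem torsion.finite (hodd : Odd p) (hF : ∀ n, ∃ ζ : F, IsPrimitiveRoot ζ (p ^ n)) :
    Finite (torsion p F) := by
  obtain ⟨ζ, hζ⟩ := Qmu.exists_isPrimitiveRoot hF 1
  rw [pow_one] at hζ
  let f : torsion p F → Polynomial.nthRootsFinset p (1 : Qmu p F) := fun σ =>
    ⟨σ.1 ζ, (Polynomial.mem_nthRootsFinset hp.out.pos _).2 (by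
      rw [← map_pow, hζ.pow_eq_one, map_one])⟩
  refine Finite.of_injective f fun σ τ h => ?_
  have h1 : σ.1 ζ = τ.1 ζ := congrArg Subtype.val h
  have h2 : ((τ⁻¹ * σ : torsion p F) : Gal(Qmu p F/ℚ)) = 1 := by
    refine Qmu.eq_one_of_isOfFinOrder hodd hF (torsion.isOfFinOrder hF (τ⁻¹ * σ).2) hζ ?_
    rw [Subgroup.coe_mul, AlgEquiv.mul_apply, h1, ← AlgEquiv.mul_apply, ← Subgroup.coe_mul,
      inv_mul_cancel]
    rfl
  exact (inv_mul_eq_one.1 (Subtype.ext h2)).symm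

theorem torsion.card_coprime (hodd : Odd p) (hF : ∀ n, ∃ ζ : F, IsPrimitiveRoot ζ (p ^ n)) :
    (Nat.card (torsion p F)).Coprime p := by
  have := torsion.finite hodd hF
  refine coprime_of_no_order fun σ hσ => ?_
  obtain ⟨ζ, hζ⟩ := Qmu.exists_isPrimitiveRoot hF 1
  rw [pow_one] at hζ
  have : NeZero p := ⟨hp.out.ne_zero⟩
  obtain ⟨a, ha⟩ := exists_apply_eq_pow σ.1 hζ
  refine Subtype.ext (Qmu.eq_one_of_isOfFinOrder hodd hF (torsion.isOfFinOrder hF σ.2) hζ ?_)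
  have h1 := pow_apply_eq_pow ha p
  rw [← Subgroup.coe_pow, hσ] at h1
  -- `a ^ p ≡ a` modulo `p` by Fermat's little theorem
  have h2 : a ^ p ≡ a [MOD p] := by
    rw [← ZMod.natCast_eq_natCast_iff]
    push_cast
    exact ZMod.pow_card _
  rw [ha, ← (pow_eq_pow_iff_modEq_of_isPrimitiveRoot hζ).2 h2, ← h1]
  rfl

/-- By infinite Galois theory `Δ` is the torsion subgroup itself, which is finite, hence closed. -/
theorem Delta_eq_torsion [IsGalois ℚ F] (hodd : Odd p)
    (hF : ∀ n, ∃ ζ : F, IsPrimitiveRoot ζ (p ^ n)) : Delta p F = torsion p F := by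
  have := torsion.finite hodd hF
  have hT2 : T2Space Gal(Qmu p F/ℚ) := krullTopology_t2
  have hcl : IsClosed (torsion p F : Set Gal(Qmu p F/ℚ)) := (Set.toFinite _).isClosed
  exact InfiniteGalois.fixingSubgroup_fixedField (⟨torsion p F, hcl⟩ : ClosedSubgroup _)

theorem Delta.finite [IsGalois ℚ F] (hodd : Odd p)
    (hF : ∀ n, ∃ ζ : F, IsPrimitiveRoot ζ (p ^ n)) : Finite (Delta p F) := by
  rw [Delta_eq_torsion hodd hF]
  exact torsion.finite hodd hF

theorem Delta.card_coprime [IsGalois ℚ F] (hodd : Odd p)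
    (hF : ∀ n, ∃ ζ : F, IsPrimitiveRoot ζ (p ^ n)) : (Nat.card (Delta p F)).Coprime p := by
  rw [Delta_eq_torsion hodd hF]
  exact torsion.card_coprime hodd hF

/-- If `γ` topologically generates `A`, then it generates every quotient by an open subgroup, so
that powers of `γ` lying in the subgroup have exponents divisible by the index. -/
theorem index_dvd_of_pow_mem {A : Type*} [Group A] [TopologicalSpace A] [IsTopologicalGroup A]
    {γ : A} (hγ : Dense (Subgroup.zpowers γ : Set A)) {U : Subgroup A} [U.Normal]
    (hU : IsOpen (U : Set A)) {k : ℕ} (hk : γ ^ k ∈ U) : U.index ∣ k := by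
  have h1 : orderOf (γ : A ⧸ U) = Nat.card (A ⧸ U) := by
    refine orderOf_eq_card_of_forall_mem_zpowers fun x => ?_
    induction x using QuotientGroup.induction_on with
    | H g =>
      obtain ⟨j, hj⟩ := exists_zpow_mem_coset hγ hU g
      exact ⟨j, (QuotientGroup.eq.2 hj).symm⟩
  rw [Subgroup.index_eq_card, ← h1, orderOf_dvd_iff_pow_eq_one, ← QuotientGroup.mk_pow,
    QuotientGroup.eq_one_iff]
  exact hk

/-- The finite layers of `ℚ^cyc`: the images of the subgroups `Gal(ℚ(μ_{p^∞})/ℚ(ζ_{p^{N+1}}))` are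
open subgroups of `Γ` of index divisible by `p ^ N`. -/
theorem exists_isOpen_pow_dvd [IsGalois ℚ F] (hodd : Odd p)
    (hF : ∀ n, ∃ ζ : F, IsPrimitiveRoot ζ (p ^ n)) {γ : Gal(Qmu p F/ℚ) ⧸ Delta p F}
    (hγ : Dense (Subgroup.zpowers γ : Set (Gal(Qmu p F/ℚ) ⧸ Delta p F))) (N : ℕ) :
    ∃ U : Subgroup (Gal(Qmu p F/ℚ) ⧸ Delta p F),
      IsOpen (U : Set (Gal(Qmu p F/ℚ) ⧸ Delta p F)) ∧ ∀ k : ℕ, γ ^ k ∈ U → p ^ N ∣ k := by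
  obtain ⟨ζ, hζ⟩ := Qmu.exists_isPrimitiveRoot hF (N + 1)
  let K : IntermediateField ℚ (Qmu p F) := IntermediateField.adjoin ℚ {ζ}
  have hcyc : IsCyclotomicExtension {p ^ (N + 1)} ℚ K :=
    hζ.intermediateField_adjoin_isCyclotomicExtension ℚ
  have hfin : FiniteDimensional ℚ K := IsCyclotomicExtension.finite_of_singleton (p ^ (N + 1)) ℚ K
  have hidx : p ^ N ∣ K.fixingSubgroup.index := by
    rw [← IntermediateField.finrank_eq_fixingSubgroup_index,
      IsCyclotomicExtension.finrank K
        (Polynomial.cyclotomic.irreducible_rat (pow_pos hp.out.pos (N + 1))),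
      Nat.totient_prime_pow_succ hp.out]
    exact dvd_mul_right _ _
  have hcomm := Qmu.gal_comm hF
  have hopen : IsOpen (K.fixingSubgroup.map (QuotientGroup.mk' (Delta p F)) :
      Set (Gal(Qmu p F/ℚ) ⧸ Delta p F)) :=
    QuotientGroup.isOpenMap_coe _ (IntermediateField.fixingSubgroup_isOpen K)
  have hnorm : (K.fixingSubgroup.map (QuotientGroup.mk' (Delta p F))).Normal := by
    refine ⟨fun n hn g => ?_⟩
    have : g * n = n * g := by
      induction g using QuotientGroup.induction_on with
      | H g =>
        induction n using QuotientGroup.induction_on with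
        | H n => rw [← QuotientGroup.mk_mul, hcomm, QuotientGroup.mk_mul]
    rwa [this, mul_inv_cancel_right]
  refine ⟨_, hopen, fun k hk => dvd_trans ?_ (index_dvd_of_pow_mem hγ hopen hk)⟩
  rw [Subgroup.index_map, QuotientGroup.ker_mk', QuotientGroup.range_mk', Subgroup.index_top,
    mul_one]
  have h1 : K.fixingSubgroup.relIndex (K.fixingSubgroup ⊔ Delta p F) ∣ Nat.card (Delta p F) := by
    have : K.fixingSubgroup.Normal :=
      ⟨fun n hn g => by rwa [hcomm g n, mul_inv_cancel_right]⟩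
    rw [sup_comm, Subgroup.relIndex_sup_right]
    exact Subgroup.relIndex_dvd_card _ _
  rw [← Subgroup.relIndex_mul_index (le_sup_left (a := K.fixingSubgroup) (b := Delta p F))] at hidx
  refine Nat.Coprime.dvd_of_dvd_mul_left ?_ hidx
  exact Nat.Coprime.pow_left _
    (Nat.Coprime.symm ((Delta.card_coprime hodd hF).coprime_dvd_left h1))

end Cyclotomic

/-! ### Selmer groups in extensions of degree prime to `p` -/

section SelmerRestriction

variable (E : WeierstrassCurve ℚ) (p : ℕ)

theorem Ptor.isOpen_stabilizer {F : Type*} [Field F] [Algebra ℚ F] [Algebra.IsIntegral ℚ F]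
    (P : Ptor E p F) : IsOpen (MulAction.stabilizer Gal(F/ℚ) P : Set Gal(F/ℚ)) := by
  obtain ⟨P, hP⟩ := P
  cases P with
  | zero =>
    have : (MulAction.stabilizer Gal(F/ℚ) (⟨_, hP⟩ : Ptor E p F) : Set Gal(F/ℚ)) = Set.univ :=
      Set.eq_univ_of_forall fun g => rfl
    rw [this]
    exact isOpen_univ
  | some x y h =>
    refine Subgroup.isOpen_mono (H₁ := MulAction.stabilizer Gal(F/ℚ) x ⊓
      MulAction.stabilizer Gal(F/ℚ) y) (fun g hg => ?_)
      ((stabilizer_isOpen_of_isIntegral x).inter (stabilizer_isOpen_of_isIntegral y))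
    obtain ⟨hx, hy⟩ := hg
    replace hx : g • x = x := hx
    replace hy : g • y = y := hy
    refine Subtype.ext ?_
    exact (WeierstrassCurve.Affine.Point.some.injEq _ _ _ _ _ _).mpr ⟨hx, hy⟩

theorem Ptor.exists_pow_nsmul_eq_zero {F : Type*} [Field F] [Algebra ℚ F] (P : Ptor E p F) :
    ∃ n : ℕ, p ^ n • P = 0 := by
  obtain ⟨n, hn⟩ := P.2
  exact ⟨n, Subtype.ext hn⟩

theorem localField_mono {k K F : Type*} [Field k] [Field K] [Algebra k K] [Algebra ℚ k]
    [Algebra ℚ K] [IsScalarTower ℚ k K] [Field F] [Algebra ℚ F] {L₁ L₂ : IntermediateField ℚ F}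
    (h : L₁ ≤ L₂) (τ : F →ₐ[ℚ] K) : localField k L₁ τ ≤ localField k L₂ τ :=
  IntermediateField.adjoin.mono _ _ _ (Set.image_mono h)

theorem mem_fixingSubgroup_localField {k K F : Type*} [Field k] [Field K] [Algebra k K]
    [Algebra ℚ k] [Algebra ℚ K] [IsScalarTower ℚ k K] [Field F] [Algebra ℚ F] [Normal ℚ F]
    {L : IntermediateField ℚ F} {τ : F →ₐ[ℚ] K} {σ : Gal(K/k)}
    (hσ : restrictAlong τ σ ∈ L.fixingSubgroup) : σ ∈ (localField k L τ).fixingSubgroup := by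
  have h1 : localField k L τ ≤
      IntermediateField.fixedField (L.fixingSubgroup.comap (restrictAlong (k := k) τ)) := by
    refine IntermediateField.adjoin_le_iff.2 ?_
    rintro _ ⟨x, hx, rfl⟩
    rw [SetLike.mem_coe, IntermediateField.mem_fixedField_iff]
    intro f hf
    rw [← restrictAlong_commutes τ f x]
    exact congrArg τ ((IntermediateField.mem_fixingSubgroup_iff _ _).1 hf x hx)
  exact (IntermediateField.le_iff_le _ _).1 h1 hσ

/-- The local conditions over `L₁` and `L₂` agree for classes defined over `L₁` if the degree of
`L₂/L₁` is prime to `p`: the kernel of restriction from `(L₁)_w` to `(L₂)_w` is killed by this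
degree, whereas the localization of a class is killed by a power of `p`. -/
theorem locMap_eq_zero_iff_res {k K F : Type*} [Field k] [Field K] [Algebra k K] [Algebra ℚ k]
    [Algebra ℚ K] [IsScalarTower ℚ k K] [Field F] [Algebra ℚ F] [IsGalois ℚ F]
    {L₁ L₂ : IntermediateField ℚ F} [L₂.fixingSubgroup.Normal] (hL : L₁ ≤ L₂)
    (h : L₂.fixingSubgroup ≤ L₁.fixingSubgroup)
    [Finite (L₁.fixingSubgroup ⧸ L₂.fixingSubgroup.subgroupOf L₁.fixingSubgroup)]
    (hcop : (Nat.card (L₁.fixingSubgroup ⧸ L₂.fixingSubgroup.subgroupOf L₁.fixingSubgroup)).Coprime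
      p) (τ : F →ₐ[ℚ] K) (c : H1 L₁.fixingSubgroup (Ptor E p F)) :
    locMap E p (k := k) L₁ τ c = 0 ↔ locMap E p (k := k) L₂ τ (H1.res _ h c) = 0 := by
  induction c using QuotientAddGroup.induction_on with
  | H z =>
    obtain ⟨z', h1, h1'⟩ := H1.res_mk h z
    rw [h1, locMap_mk_eq_zero_iff, locMap_mk_eq_zero_iff]
    have hres : ∀ (σ : Gal(K/k)) (h₁ : σ ∈ (localField k L₁ τ).fixingSubgroup)
        (h₂ : σ ∈ (localField k L₂ τ).fixingSubgroup),
        z'.1 (localRes k L₂ τ ⟨σ, h₂⟩) = z.1 (localRes k L₁ τ ⟨σ, h₁⟩) := fun σ h₁ h₂ => h1' _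
    constructor
    · rintro ⟨P, hP⟩
      refine ⟨P, fun σ => ?_⟩
      have hσ := IntermediateField.fixingSubgroup_le (localField_mono (k := k) hL τ) σ.2
      rw [hres σ.1 hσ σ.2]
      exact hP ⟨σ.1, hσ⟩
    · rintro ⟨P, hP⟩
      have hcomp : CompactSpace L₁.fixingSubgroup :=
        isCompact_iff_compactSpace.1 (InfiniteGalois.fixingSubgroup_isClosed L₁).isCompact
      obtain ⟨n, hn⟩ := exists_pow_nsmul_eq_zero p (Ptor.exists_pow_nsmul_eq_zero E p) z.1 z.2.1
      refine exists_eq_coboundary_of_coprime (Nat.Coprime.pow_right n hcop) _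
        (exists_card_nsmul_eq_coboundary
          ((QuotientGroup.mk' (L₂.fixingSubgroup.subgroupOf L₁.fixingSubgroup)).comp
            (localRes k L₁ τ)) _ ?_ ⟨P, fun σ hσ => ?_⟩) ⟨0, fun σ => ?_⟩
      · intro σ σ'
        rw [map_mul, z.2.2]
        show Pt.map E τ (_ + _) = _
        rw [map_add]
        congr 1
        show Pt.map E τ (Pt.map E _ (z.1 _).1) = Pt.map E _ (Pt.map E τ (z.1 _).1)
        rw [← Pt.map_comp, ← Pt.map_comp]
        congr 2
        ext x
        exact restrictAlong_commutes τ σ.1 x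
      · rw [MonoidHom.comp_apply, QuotientGroup.mk'_apply, QuotientGroup.eq_one_iff,
          Subgroup.mem_subgroupOf] at hσ
        have h₂ : σ.1 ∈ (localField k L₂ τ).fixingSubgroup := mem_fixingSubgroup_localField hσ
        have := hP ⟨σ.1, h₂⟩
        rw [hres σ.1 σ.2 h₂] at this
        exact this
      · rw [← map_nsmul, smul_zero, sub_zero, ← AddSubgroup.coe_nsmul, hn]
        exact map_zero _

variable {E p} {S : Finset Nat.Primes} {L₁ L₂ : IntermediateField ℚ (QSigma S)}

theorem Sel.res_mem_iff [L₂.fixingSubgroup.Normal] (hL : L₁ ≤ L₂)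
    (h : L₂.fixingSubgroup ≤ L₁.fixingSubgroup)
    [Finite (L₁.fixingSubgroup ⧸ L₂.fixingSubgroup.subgroupOf L₁.fixingSubgroup)]
    (hcop : (Nat.card (L₁.fixingSubgroup ⧸ L₂.fixingSubgroup.subgroupOf L₁.fixingSubgroup)).Coprime
      p) (c : H1 L₁.fixingSubgroup (Ptor E p (QSigma S))) :
    c ∈ Sel E p S L₁ ↔ H1.res _ h c ∈ Sel E p S L₂ := by
  simp only [Sel, AddMonoidHom.mem_ker, lambda, funext_iff]
  exact forall_congr' fun x => locMap_eq_zero_iff_res E p hL h hcop x.2 c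

/-- Restriction identifies `Sel(E/L₁)` with the invariants of `Gal(ℚ_Σ/L₁)` in `Sel(E/L₂)`, if
`L₂/L₁` is finite of degree prime to `p`. -/
theorem Sel.exists_res_equiv [IsGalois ℚ L₁] [IsGalois ℚ L₂] (hL : L₁ ≤ L₂)
    [Finite (L₁.fixingSubgroup ⧸ L₂.fixingSubgroup.subgroupOf L₁.fixingSubgroup)]
    (hcop : (Nat.card (L₁.fixingSubgroup ⧸ L₂.fixingSubgroup.subgroupOf L₁.fixingSubgroup)).Coprime
      p) :
    ∃ f : Sel E p S L₁ →+ Sel E p S L₂, Function.Injective f ∧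
      (∀ (g : Gal(QSigma S/ℚ)) c, f (g • c) = g • f c) ∧
      ∀ d, (∀ g ∈ L₁.fixingSubgroup, g • d = d) → ∃ c, f c = d := by
  have h := IntermediateField.fixingSubgroup_le hL
  have hcl : ∀ L : IntermediateField ℚ (QSigma S), 
      IsClosed (L.fixingSubgroup : Set Gal(QSigma S/ℚ)) :=
    fun L => InfiniteGalois.fixingSubgroup_isClosed L
  have hcomp : ∀ L : IntermediateField ℚ (QSigma S), CompactSpace L.fixingSubgroup :=
    fun L => isCompact_iff_compactSpace.1 (hcl L).isCompact
  have := hcomp L₁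
  have := hcomp L₂
  have hM := Ptor.exists_pow_nsmul_eq_zero E p (F := QSigma S)
  refine ⟨((H1.res _ h).comp (Sel E p S L₁).subtype).codRestrict (Sel E p S L₂)
    fun c => (Sel.res_mem_iff hL h hcop c.1).1 c.2, ?_, ?_, ?_⟩
  · intro a b hab
    exact Subtype.ext (H1.res_injective h hcop hM (congrArg Subtype.val hab))
  · intro g c
    exact Subtype.ext (H1.res_smul h g c.1)
  · intro d hd
    have hfi : (L₂.fixingSubgroup.subgroupOf L₁.fixingSubgroup).FiniteIndex :=
      Subgroup.finiteIndex_of_finite_quotient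
    have hopen : IsOpen (L₂.fixingSubgroup.subgroupOf L₁.fixingSubgroup : Set L₁.fixingSubgroup) :=
      Subgroup.isOpen_of_isClosed_of_finiteIndex _ ((hcl L₂).preimage continuous_subtype_val)
    have hinv : ∀ g ∈ L₁.fixingSubgroup, g • d.1 = d.1 := fun g hg =>
      congrArg Subtype.val (hd g hg)
    have hex := H1.exists_res_eq (M := Ptor E p (QSigma S)) (p := p) h hopen hcop hM d.1 hinv
    obtain ⟨c, hc⟩ := hex
    exact ⟨⟨c, (Sel.res_mem_iff hL h hcop c).2 (by rw [hc]; exact d.2)⟩, Subtype.ext hc⟩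

/-- `Sel(E/L)` is a discrete `Gal(L/ℚ)`-module. -/
theorem Sel.isOpen_stabilizer (L : IntermediateField ℚ (QSigma S)) [IsGalois ℚ L]
    (c : Sel E p S L) : IsOpen (MulAction.stabilizer Gal(L/ℚ) c : Set Gal(L/ℚ)) := by
  have hT2 : T2Space Gal(L/ℚ) := krullTopology_t2
  have hcont := InfiniteGalois.restrictNormalHom_continuous (K := QSigma S) L
  have hq := hcont.isClosedMap.isQuotientMap hcont (AlgEquiv.restrictNormalHom_surjective (QSigma S))
  rw [← hq.isOpen_preimage]
  convert H1.isOpen_stabilizer L.fixingSubgroup (InfiniteGalois.fixingSubgroup_isClosed L)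
    (Ptor.isOpen_stabilizer E p) c.1 using 1
  ext g
  rw [Set.mem_preimage, SetLike.mem_coe, SetLike.mem_coe, MulAction.mem_stabilizer_iff,
    MulAction.mem_stabilizer_iff, Sel.restrict_smul, Subtype.ext_iff]
  rfl

theorem Sel.exists_pow_nsmul_eq_zero (L : IntermediateField ℚ (QSigma S)) (c : Sel E p S L) :
    ∃ n : ℕ, p ^ n • c = 0 := by
  have : CompactSpace L.fixingSubgroup :=
    isCompact_iff_compactSpace.1 (InfiniteGalois.fixingSubgroup_isClosed L).isCompact
  obtain ⟨n, hn⟩ := H1.exists_pow_nsmul_eq_zero p (Ptor.exists_pow_nsmul_eq_zero E p) c.1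
  exact ⟨n, Subtype.ext hn⟩

end SelmerRestriction

/-! ### Comparison of the two Euler characteristics -/

section Comparison

theorem H0.isOpen_stabilizer {G D : Type*} [Group G] [TopologicalSpace G] [IsTopologicalGroup G]
    (H : Subgroup G) [H.Normal] [AddCommGroup D] [DistribMulAction G D]
    (hopen : ∀ d : D, IsOpen (MulAction.stabilizer G d : Set G)) (d : H0 H D) :
    IsOpen (MulAction.stabilizer (G ⧸ H) d : Set (G ⧸ H)) := by
  rw [← (QuotientGroup.isQuotientMap_mk (N := H)).isOpen_preimage]
  convert hopen d.1 using 1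
  ext g
  rw [Set.mem_preimage, SetLike.mem_coe, SetLike.mem_coe, MulAction.mem_stabilizer_iff,
    MulAction.mem_stabilizer_iff, Subtype.ext_iff, H0.mk_smul]

/-- Comparison of modules over two quotients `Γ` and `Γ'` of a group `G`: an equivariant embedding
`D₁ → D₂` onto the invariants of `H ≤ Γ'` identifies the truncated Euler characteristics. -/
theorem chi_eq_chi_H0_of_equivariant {G Γ Γ' D₁ D₂ : Type*} [Group G] [Group Γ] [Group Γ']
    [AddCommGroup D₁] [AddCommGroup D₂] [DistribMulAction G D₁] [DistribMulAction G D₂]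
    [DistribMulAction Γ D₁] [DistribMulAction Γ' D₂] (H : Subgroup Γ') [H.Normal]
    (π₁ : G →* Γ) (π₂ : G →* Γ') (hπ₁ : Function.Surjective π₁) (hπ₂ : Function.Surjective π₂)
    (h₁ : ∀ g (d : D₁), π₁ g • d = g • d) (h₂ : ∀ g (d : D₂), π₂ g • d = g • d)
    (htriv : ∀ g, π₂ g ∈ H → ∀ d : D₁, g • d = d) (f : D₁ →+ D₂) (hinj : Function.Injective f)
    (hf : ∀ (g : G) d, f (g • d) = g • f d)
    (hsurj : ∀ d : D₂, (∀ g, π₂ g ∈ H → g • d = d) → ∃ c, f c = d) :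
    (HasFiniteChi Γ D₁ ↔ HasFiniteChi (Γ' ⧸ H) (H0 H D₂)) ∧
      chi Γ D₁ = chi (Γ' ⧸ H) (H0 H D₂) := by
  have hinv : ∀ c, f c ∈ H0 H D₂ := by
    rintro c ⟨δ, hδ⟩
    obtain ⟨g, rfl⟩ := hπ₂ δ
    rw [Subgroup.mk_smul, h₂, ← hf, htriv g hδ]
  let e : D₁ ≃+ H0 H D₂ :=
    AddEquiv.ofBijective (f.codRestrict _ hinv) ⟨fun a b h => hinj (congrArg Subtype.val h), by
      intro d
      obtain ⟨c, hc⟩ := hsurj d.1 fun g hg => by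
        rw [← h₂]
        exact d.2 ⟨_, hg⟩
      exact ⟨c, Subtype.ext hc⟩⟩
  have key : ∀ (g : G) (c : D₁), e (π₁ g • c) = (π₂ g : Γ' ⧸ H) • e c := by
    intro g c
    refine Subtype.ext ?_
    rw [H0.mk_smul, h₁, h₂]
    exact hf g c
  refine chi_congr e (fun g => ?_) fun g' => ?_
  · obtain ⟨g, rfl⟩ := hπ₁ g
    exact ⟨_, key g⟩
  · induction g' using QuotientGroup.induction_on with
    | H g' =>
      obtain ⟨g, rfl⟩ := hπ₂ g'
      exact ⟨_, key g⟩

/-- `χ_t(G/H, D^H) = χ_t(G, D)` for a discrete `p`-primary `G`-module `D`, if `H` is finite of order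
prime to `p` and `G/H` is procyclic with quotients of order divisible by arbitrary powers of `p`. -/
theorem chiG_eq_chi_of_coprime {G D : Type*} [Group G] [TopologicalSpace G] [IsTopologicalGroup G]
    [CompactSpace G] (H : Subgroup G) [H.Normal] [Finite H] [AddCommGroup D]
    [DistribMulAction G D] {p : ℕ} [Fact p.Prime] (hcop : (Nat.card H).Coprime p) {γ : G ⧸ H}
    (hγ : Dense (Subgroup.zpowers γ : Set (G ⧸ H))) (hcomm : ∀ a b : G, a * b = b * a)
    (hopen : ∀ d : D, IsOpen (MulAction.stabilizer G d : Set G))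
    (hD : ∀ d : D, ∃ n : ℕ, p ^ n • d = 0)
    (hU : ∀ N : ℕ, ∃ U : Subgroup (G ⧸ H), IsOpen (U : Set (G ⧸ H)) ∧
      ∀ k : ℕ, γ ^ k ∈ U → p ^ N ∣ k) :
    (HasFiniteChi (G ⧸ H) (H0 H D) ↔ HasFiniteChiG H D γ) ∧
      chi (G ⧸ H) (H0 H D) = chiG H D γ := by
  have hcomm' : ∀ a b : G ⧸ H, a * b = b * a := by
    intro a b
    induction a using QuotientGroup.induction_on with
    | H a =>
      induction b using QuotientGroup.induction_on with
      | H b => rw [← QuotientGroup.mk_mul, hcomm, QuotientGroup.mk_mul]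
  have hopen' := H0.isOpen_stabilizer H hopen
  have hD' : ∀ d : H0 H D, ∃ n : ℕ, p ^ n • d = 0 := fun d => by
    obtain ⟨n, hn⟩ := hD d.1
    exact ⟨n, Subtype.ext hn⟩
  exact chiG_eq_chi H D γ
    ⟨evalAt_injective hγ hopen', evalAt_surjective hγ hcomm' hopen' hD' hU⟩
    ⟨inflation_injective H D, inflation_surjective H D hcop hD hopen⟩

variable {p : ℕ}

theorem Sel.smul_of_mem_fixingSubgroup {E : WeierstrassCurve ℚ} {S : Finset Nat.Primes}
    (L : IntermediateField ℚ (QSigma S)) [IsGalois ℚ L] {g : Gal(QSigma S/ℚ)}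
    (hg : g ∈ L.fixingSubgroup) (c : Sel E p S L) : g • c = c :=
  Subtype.ext (H1.smul_of_mem L.fixingSubgroup g hg c.1)

variable {F : Type*} [Field F] [Algebra ℚ F]

theorem Qcyc_le_Qmu : Qcyc p F ≤ Qmu p F := IntermediateField.lift_le _

theorem mem_fixingSubgroup_Qcyc_iff [IsGalois ℚ F] (g : Gal(F/ℚ)) :
    g ∈ (Qcyc p F).fixingSubgroup ↔
      AlgEquiv.restrictNormalHom (F := ℚ) (K₁ := F) (Qmu p F) g ∈ Delta p F := by
  have hcomm : ∀ x : Qmu p F,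
      ((AlgEquiv.restrictNormalHom (F := ℚ) (K₁ := F) (Qmu p F) g x : Qmu p F) : F) = g x :=
    fun x => AlgEquiv.restrictNormal_commutes g (Qmu p F) x
  rw [Delta, IntermediateField.mem_fixingSubgroup_iff, IntermediateField.mem_fixingSubgroup_iff]
  constructor
  · intro h x hx
    refine Subtype.ext ((hcomm x).trans (h x ?_))
    exact (IntermediateField.mem_lift x).2 hx
  · intro h x hx
    have h1 := h ⟨x, Qcyc_le_Qmu hx⟩ ((IntermediateField.mem_lift _).1 hx)
    exact (hcomm ⟨x, Qcyc_le_Qmu hx⟩).symm.trans (congrArg Subtype.val h1)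

/-- `Gal(F/ℚ^cyc)/Gal(F/ℚ(μ_{p^∞}))` embeds into `Δ`, hence has order prime to `p`. -/
theorem Qcyc.finite_and_coprime [IsGalois ℚ F] [Finite (Delta p F)]
    (hcop : (Nat.card (Delta p F)).Coprime p) :
    Finite ((Qcyc p F).fixingSubgroup ⧸
        (Qmu p F).fixingSubgroup.subgroupOf (Qcyc p F).fixingSubgroup) ∧
      (Nat.card ((Qcyc p F).fixingSubgroup ⧸
        (Qmu p F).fixingSubgroup.subgroupOf (Qcyc p F).fixingSubgroup)).Coprime p := by
  let ρ : (Qcyc p F).fixingSubgroup →* Delta p F :=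
    ((AlgEquiv.restrictNormalHom (F := ℚ) (K₁ := F) (Qmu p F)).comp
      (Subgroup.subtype _)).codRestrict (Delta p F) fun g => (mem_fixingSubgroup_Qcyc_iff g.1).1 g.2
  have hker : ρ.ker = (Qmu p F).fixingSubgroup.subgroupOf (Qcyc p F).fixingSubgroup := by
    ext g
    have h1 := SetLike.ext_iff.1 (IntermediateField.restrictNormalHom_ker (Qmu p F)) g.1
    rw [Subgroup.mem_subgroupOf, ← h1, MonoidHom.mem_ker, MonoidHom.mem_ker, Subtype.ext_iff]
    rfl
  rw [← hker]
  refine ⟨Finite.of_equiv _ (QuotientGroup.quotientKerEquivRange ρ).symm.toEquiv, ?_⟩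
  rw [Nat.card_congr (QuotientGroup.quotientKerEquivRange ρ).toEquiv]
  exact hcop.coprime_dvd_left (Subgroup.card_subgroup_dvd_card _)

/-- `χ_t(Γ, Sel(E/ℚ^cyc)) = χ_t(Γ, Sel(E/ℚ(μ_{p^∞}))^Δ)`. -/
theorem chi_Sel_Qcyc (E : WeierstrassCurve ℚ) (S : Finset Nat.Primes)
    [Finite (Delta p (QSigma S))] (hcop : (Nat.card (Delta p (QSigma S))).Coprime p) :
    (HasFiniteChi Gal(Qcyc p (QSigma S)/ℚ) (Sel E p S (Qcyc p (QSigma S))) ↔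
      HasFiniteChi (Gal(Qmu p (QSigma S)/ℚ) ⧸ Delta p (QSigma S))
        (H0 (Delta p (QSigma S)) (Sel E p S (Qmu p (QSigma S))))) ∧
    chi Gal(Qcyc p (QSigma S)/ℚ) (Sel E p S (Qcyc p (QSigma S))) =
      chi (Gal(Qmu p (QSigma S)/ℚ) ⧸ Delta p (QSigma S))
        (H0 (Delta p (QSigma S)) (Sel E p S (Qmu p (QSigma S)))) := by
  have hQ := Qcyc.finite_and_coprime (F := QSigma S) hcop
  have hfin := hQ.1
  have hex := Sel.exists_res_equiv (E := E) (p := p) (S := S)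
    (L₁ := Qcyc p (QSigma S)) (L₂ := Qmu p (QSigma S)) Qcyc_le_Qmu hQ.2
  obtain ⟨f, hinj, hsmul, hsurj⟩ := hex
  exact chi_eq_chi_H0_of_equivariant (Delta p (QSigma S))
    (AlgEquiv.restrictNormalHom (F := ℚ) (K₁ := QSigma S) (Qcyc p (QSigma S)))
    (AlgEquiv.restrictNormalHom (F := ℚ) (K₁ := QSigma S) (Qmu p (QSigma S)))
    (AlgEquiv.restrictNormalHom_surjective (QSigma S))
    (AlgEquiv.restrictNormalHom_surjective (QSigma S))
    (Sel.restrict_smul E p S (Qcyc p (QSigma S))) (Sel.restrict_smul E p S (Qmu p (QSigma S)))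
    (fun g hg c => Sel.smul_of_mem_fixingSubgroup _ ((mem_fixingSubgroup_Qcyc_iff g).2 hg) c)
    f hinj hsmul (fun d hd => hsurj d fun g hg => hd g ((mem_fixingSubgroup_Qcyc_iff g).1 hg))

end Comparison

end TruncatedEuler

end

open TruncatedEuler in
theorem proposition3p9 (p : ℕ) [Fact p.Prime] (hp : 5 ≤ p)
    (E : WeierstrassCurve ℚ) [E.IsElliptic] (hE : GoodOrdinaryAt E p)
    (S : Finset Nat.Primes) (hpS : (⟨p, Fact.out⟩ : Nat.Primes) ∈ S)
    (hbad : ∀ l : Nat.Primes, ¬ GoodAt E l → l ∈ S)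
    (γ : Gal(Qmu p (QSigma S)/ℚ) ⧸ Delta p (QSigma S))
    (hγ : Dense (Subgroup.zpowers γ : Set (Gal(Qmu p (QSigma S)/ℚ) ⧸ Delta p (QSigma S)))) :
    (HasFiniteChi Gal(Qcyc p (QSigma S)/ℚ) (Sel E p S (Qcyc p (QSigma S))) ↔
      HasFiniteChiG (Delta p (QSigma S)) (Sel E p S (Qmu p (QSigma S))) γ) ∧
    (HasFiniteChi Gal(Qcyc p (QSigma S)/ℚ) (Sel E p S (Qcyc p (QSigma S))) →
      chi Gal(Qcyc p (QSigma S)/ℚ) (Sel E p S (Qcyc p (QSigma S))) =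
        chiG (Delta p (QSigma S)) (Sel E p S (Qmu p (QSigma S))) γ) := by
  have hodd : Odd p := (Fact.out : p.Prime).odd_of_ne_two (by omega)
  have hF := QSigma.exists_isPrimitiveRoot hpS
  have hfin := Delta.finite hodd hF
  have hcop := Delta.card_coprime hodd hF
  have hS := chi_Sel_Qcyc E S hcop
  have hD := chiG_eq_chi_of_coprime (D := Sel E p S (Qmu p (QSigma S))) (Delta p (QSigma S)) hcop hγ
    (Qmu.gal_comm hF) (Sel.isOpen_stabilizer _) (Sel.exists_pow_nsmul_eq_zero _)
    (exists_isOpen_pow_dvd hodd hF hγ)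
  exact ⟨hS.1.trans hD.1, fun _ => hS.2.trans hD.2⟩
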